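/- Call two smooth real functions, each defined on some half-line $(u,\infty)$, equivalent if they agree for all sufficiently large arguments; the equivalence classes (germs at infinity) form a ring. A Hardy field is a subfield of this ring that is closed under differentiation. A function $h$ has growth rate $c\in\mathbb{R}$ if $c=\inf\{\alpha\in\mathbb{R} : |h(t)|\le t^\alpha \text{ for all sufficiently large } t\}$. Let $1<c<\frac65$ and let $h:\mathbb{R}\to\mathbb{R}$ be an eventually positive function whose germ at infinity belongs to a Hardy field and which has growth rate $c$. Put $S_h=\{\lfloor h(n)\rfloor : n=1,2,3,\dots\}\subseteq\mathbb{Z}$ and, for integers $N\ge 1$ and $n$, $$F_N^{\mathbb{Z}}(n)=\max\Bigl(1-\frac{|n|}{N},\,0\Bigr),\qquad \Psi_N(n)=F_N^{\mathbb{Z}}(n)\,1_{S_h}(n).$$ (1) For every $\varepsilon>0$ there is a constant $C>0$, depending only on $h$ and $\varepsilon$, such that for all integers $N\ge 1$ and all $\xi\in\mathbb{R}$ $$\frac1N\sum_{n=1}^N \Psi_N(n)\cos(2\pi\xi n)\ \ge\ -C\,N^{-\frac{1}{5c}+\varepsilon}.$$ (2) There is an integer $N_0$, depending only on $h$, such that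 for every $\varepsilon>0$ there is a constant $C'>0$, depending only on $h$ and $\varepsilon$, with $$\frac1N\sum_{n=1}^N \Psi_N(n)\ \ge\ C'\,N^{-(1-\frac1c+\varepsilon)}\qquad\text{for all integers } N\ge N_0 .$$ -/

import Mathlib

open Filter

open scoped ContDiff

/-- The ring of germs at infinity of smooth real functions, each defined on some `(u, ∞)`. -/
def smoothGerms : Subring (Germ (atTop : Filter ℝ) ℝ) where
  carrier := {g | ∃ (f : ℝ → ℝ) (u : ℝ), ContDiffOn ℝ ∞ f (Set.Ioi u) ∧ g = (f : Germ atTop ℝ)}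
  mul_mem' := by
    rintro _ _ ⟨f, u, hf, rfl⟩ ⟨g, v, hg, rfl⟩
    refine ⟨f * g, max u v, ?_, rfl⟩
    exact (hf.mono (Set.Ioi_subset_Ioi (le_max_left u v))).mul
      (hg.mono (Set.Ioi_subset_Ioi (le_max_right u v)))
  one_mem' := ⟨1, 0, contDiffOn_const, rfl⟩
  add_mem' := by
    rintro _ _ ⟨f, u, hf, rfl⟩ ⟨g, v, hg, rfl⟩
    refine ⟨f + g, max u v, ?_, rfl⟩
    exact (hf.mono (Set.Ioi_subset_Ioi (le_max_left u v))).add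
      (hg.mono (Set.Ioi_subset_Ioi (le_max_right u v)))
  zero_mem' := ⟨0, 0, contDiffOn_const, rfl⟩
  neg_mem' := by
    rintro _ ⟨f, u, hf, rfl⟩
    exact ⟨-f, u, hf.neg, rfl⟩

/-- Functions that agree near infinity have derivatives that agree near infinity. -/
theorem deriv_eventuallyEq_atTop {f g : ℝ → ℝ} (hfg : f =ᶠ[atTop] g) :
    deriv f =ᶠ[atTop] deriv g := by
  obtain ⟨T, hT⟩ := eventually_atTop.1 hfg
  filter_upwards [eventually_gt_atTop T] with t ht
  apply EventuallyEq.deriv_eq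
  filter_upwards [Ioi_mem_nhds ht] with s hs
  exact hT s (le_of_lt hs)

/-- The derivative of a germ at infinity: the germ of the derivative of a representative. -/
noncomputable def germDeriv : Germ (atTop : Filter ℝ) ℝ → Germ (atTop : Filter ℝ) ℝ :=
  Germ.map' deriv fun _ _ hfg => deriv_eventuallyEq_atTop hfg

/-- A Hardy field: a subfield of the ring of germs at infinity of smooth functions which is
closed under differentiation. -/
structure IsHardyField (H : Subring (Germ (atTop : Filter ℝ) ℝ)) : Prop where
  le_smoothGerms : H ≤ smoothGerms
  isField : IsField H
  deriv_mem : ∀ g ∈ H, germDeriv g ∈ H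

/-- `h` has growth rate `c`: `c` is the infimum of the real `α` such that `|h t| ≤ t ^ α` for all
sufficiently large `t` (that set being non-empty and bounded below). -/
def HasGrowthRate (h : ℝ → ℝ) (c : ℝ) : Prop :=
  IsGLB {α : ℝ | ∀ᶠ t : ℝ in atTop, |h t| ≤ t ^ α} c

/-- The set `{⌊h n⌋ : n = 1, 2, 3, …}` of integers. -/
def floorSet (h : ℝ → ℝ) : Set ℤ :=
  {k : ℤ | ∃ n : ℕ, 1 ≤ n ∧ k = ⌊h (n : ℝ)⌋}

/-- The Fejér kernel on the integers, `n ↦ max (1 - |n| / N) 0`. -/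
noncomputable def fejerInt (N : ℕ) (n : ℤ) : ℝ :=
  max (1 - |(n : ℝ)| / (N : ℝ)) 0

/-- The average of `f` over `{1, …, N}`. -/
noncomputable def avg (N : ℕ) (f : ℤ → ℝ) : ℝ :=
  (1 / (N : ℝ)) * ∑ n ∈ Finset.Icc 1 N, f (n : ℤ)

/-- The Fejér kernel multiplied by the indicator function of `{⌊h n⌋ : n = 1, 2, 3, …}`. -/
noncomputable def fejerFloor (h : ℝ → ℝ) (N : ℕ) : ℤ → ℝ :=
  fun n => fejerInt N n * (floorSet h).indicator (fun _ => (1 : ℝ)) n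

/-! Near infinity `h` is increasing with derivative at least `1`. Let `φ` be its inverse. For large
`n`, `n` is a value `⌊h m⌋` exactly when an integer lies in `[φ n, φ (n + 1))`, an interval of
length at most `1`. So the indicator of the floor set is `⌈φ (n + 1)⌉ - ⌈φ n⌉`, which is the smooth
density `φ (n + 1) - φ n` plus a difference of two sawtooth values
(`RegularFrom.indicator_floorSet_eq`).

The density is nonnegative, decreasing and convex in `n`, and so is its product with the Fejér
weights. A cosine sum with convex coefficients is a nonnegative combination of Fejér kernels up to
half its zeroth coefficient, hence bounded below (`neg_half_le_sum_convex_mul_cos`). The main term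
therefore costs only `O(1)`, for every frequency.

The sawtooth terms are estimated in absolute value. The sawtooth is replaced by a difference
quotient of its periodic antiderivative, whose Fourier series converges absolutely; this leaves
exponential sums with phase `ξ n + k φ n`. The linear term does not affect second differences, so
van der Corput's bound `√(k / λ)`, with `λ` a lower bound for minus the second difference of `φ`, is
uniform in `ξ`. With `K` the inverse smoothing scale the error is `N / K + K / √λ` up to a constant
(`abs_sum_fejer_sawtooth_le`), and `K` is chosen to balance it.

The Hardy field supplies the regularity: every germ has an eventual sign, so `t h' / h` and `t h'' /
h'` can be compared with rationals and the growth rate decides the outcome; the sign of the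
derivative of `h'' / h' ^ 3 = -φ'' ∘ h` makes `-φ''` monotone (`IsHardyField.exists_regularFrom`).

For the density bound, distinct large `m` give distinct floors, and `h m ≤ m ^ (c + ε)` puts about
`N ^ (1 / (c + ε))` of them below `N / 2`, where the Fejér weight is at least `1 / 2`. -/

/-! ### The Kusmin–Landau inequality -/

/-- The additive character `x ↦ exp (2πix)`. -/
noncomputable def expTwoPi (x : ℝ) : ℂ :=
  (Real.cos (2 * Real.pi * x) : ℂ) + (Real.sin (2 * Real.pi * x) : ℂ) * Complex.I

theorem expTwoPi_re (x : ℝ) : (expTwoPi x).re = Real.cos (2 * Real.pi * x) := by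
  simp [expTwoPi, -Complex.ofReal_cos, -Complex.ofReal_sin]

theorem expTwoPi_im (x : ℝ) : (expTwoPi x).im = Real.sin (2 * Real.pi * x) := by
  simp [expTwoPi, -Complex.ofReal_cos, -Complex.ofReal_sin]

theorem expTwoPi_add (x y : ℝ) : expTwoPi (x + y) = expTwoPi x * expTwoPi y := by
  apply Complex.ext
  · simp only [Complex.mul_re, expTwoPi_re, expTwoPi_im, mul_add, Real.cos_add]
  · simp only [Complex.mul_im, expTwoPi_re, expTwoPi_im, mul_add, Real.sin_add]; ring

theorem norm_expTwoPi (x : ℝ) : ‖expTwoPi x‖ = 1 := by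
  have h : ‖expTwoPi x‖ ^ 2 = 1 := by
    rw [← Complex.normSq_eq_norm_sq, Complex.normSq_apply, expTwoPi_re, expTwoPi_im]
    nlinarith [Real.sin_sq_add_cos_sq (2 * Real.pi * x)]
  nlinarith [norm_nonneg (expTwoPi x)]

theorem expTwoPi_sub_int (x : ℝ) (m : ℤ) : expTwoPi (x - m) = expTwoPi x := by
  apply Complex.ext
  · rw [expTwoPi_re, expTwoPi_re, show 2 * Real.pi * (x - m) = 2 * Real.pi * x - m * (2 * Real.pi) by ring,
      Real.cos_sub_int_mul_two_pi]
  · rw [expTwoPi_im, expTwoPi_im, show 2 * Real.pi * (x - m) = 2 * Real.pi * x - m * (2 * Real.pi) by ring,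
      Real.sin_sub_int_mul_two_pi]

/-- The inverse of `1 - exp (2πig)`. -/
noncomputable def invOneSubExp (g : ℝ) : ℂ :=
  1 / 2 + (Real.cos (Real.pi * g) / (2 * Real.sin (Real.pi * g)) : ℝ) * Complex.I

theorem invOneSubExp_mul {g : ℝ} (hg : Real.sin (Real.pi * g) ≠ 0) :
    invOneSubExp g * (1 - expTwoPi g) = 1 := by
  have h1 := Real.sin_sq_add_cos_sq (Real.pi * g)
  have e : 2 * Real.pi * g = 2 * (Real.pi * g) := by ring
  apply Complex.ext
  · simp only [invOneSubExp, Complex.mul_re, Complex.sub_re, Complex.sub_im, expTwoPi_re, expTwoPi_im]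
    simp [-Complex.ofReal_div, -Complex.ofReal_cos, -Complex.ofReal_mul]
    rw [e, Real.cos_two_mul, Real.sin_two_mul]
    field_simp
    nlinarith
  · simp only [invOneSubExp, Complex.mul_im, Complex.sub_re, Complex.sub_im, expTwoPi_re, expTwoPi_im]
    simp [-Complex.ofReal_div, -Complex.ofReal_cos, -Complex.ofReal_mul]
    rw [e, Real.cos_two_mul, Real.sin_two_mul]
    field_simp
    rw [show Real.cos (Real.pi * g) ^ 2 = 1 - Real.sin (Real.pi * g) ^ 2 by linarith]; ring

theorem two_mul_le_sin_pi_mul {g θ : ℝ} (h0 : 0 < θ) (h1 : θ ≤ g) (h2 : g ≤ 1 - θ) :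
    2 * θ ≤ Real.sin (Real.pi * g) := by
  have hp := Real.pi_pos
  rcases le_total g (1 / 2) with h | h
  · have := Real.mul_le_sin (x := Real.pi * g) (by nlinarith) (by nlinarith)
    have e : 2 / Real.pi * (Real.pi * g) = 2 * g := by field_simp
    linarith
  · have := Real.mul_le_sin (x := Real.pi * (1 - g)) (by nlinarith) (by nlinarith)
    have e : 2 / Real.pi * (Real.pi * (1 - g)) = 2 * (1 - g) := by field_simp
    rw [show Real.pi * (1 - g) = Real.pi - Real.pi * g by ring, Real.sin_pi_sub] at this
    rw [show Real.pi - Real.pi * g = Real.pi * (1 - g) by ring] at this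
    linarith

theorem norm_invOneSubExp_le {g θ : ℝ} (h0 : 0 < θ) (h1 : θ ≤ g) (h2 : g ≤ 1 - θ) :
    ‖invOneSubExp g‖ ≤ 1 / (4 * θ) := by
  have hs := two_mul_le_sin_pi_mul h0 h1 h2
  have hs0 : 0 < Real.sin (Real.pi * g) := by linarith
  have hsq : ‖invOneSubExp g‖ ^ 2 = (1 / (2 * Real.sin (Real.pi * g))) ^ 2 := by
    rw [← Complex.normSq_eq_norm_sq, Complex.normSq_apply]
    simp [invOneSubExp, -Complex.ofReal_div, -Complex.ofReal_cos, -Complex.ofReal_mul]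
    field_simp
    nlinarith [Real.sin_sq_add_cos_sq (Real.pi * g)]
  have : ‖invOneSubExp g‖ = 1 / (2 * Real.sin (Real.pi * g)) := by
    rwa [sq_eq_sq₀ (norm_nonneg _) (by positivity)] at hsq
  rw [this]
  apply one_div_le_one_div_of_le <;> linarith

theorem invOneSubExp_im (g : ℝ) :
    (invOneSubExp g).im = Real.cos (Real.pi * g) / (2 * Real.sin (Real.pi * g)) := by
  simp [invOneSubExp, -Complex.ofReal_div, -Complex.ofReal_cos, -Complex.ofReal_mul]

/-- All values lie on the line of real part `1 / 2`, with imaginary part `cot (π g) / 2` decreasing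
on `(0, 1)`. Total variation along a monotone sequence therefore telescopes. -/
theorem norm_invOneSubExp_sub {g g' : ℝ} (h0 : 0 < g') (h1 : g' ≤ g) (h2 : g < 1) :
    ‖invOneSubExp g' - invOneSubExp g‖ = (invOneSubExp g').im - (invOneSubExp g).im := by
  have hp := Real.pi_pos
  have s1 : 0 < Real.sin (Real.pi * g) := Real.sin_pos_of_pos_of_lt_pi (by nlinarith) (by nlinarith)
  have s2 : 0 < Real.sin (Real.pi * g') := Real.sin_pos_of_pos_of_lt_pi (by nlinarith) (by nlinarith)
  have s3 : 0 ≤ Real.sin (Real.pi * g - Real.pi * g') :=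
    Real.sin_nonneg_of_nonneg_of_le_pi (by nlinarith) (by nlinarith)
  rw [Real.sin_sub] at s3
  have key : 0 ≤ (invOneSubExp g').im - (invOneSubExp g).im := by
    rw [invOneSubExp_im, invOneSubExp_im, div_sub_div _ _ (by positivity) (by positivity)]
    apply div_nonneg _ (by positivity)
    nlinarith
  have e : invOneSubExp g' - invOneSubExp g =
      (((invOneSubExp g').im - (invOneSubExp g).im : ℝ) : ℂ) * Complex.I := by
    rw [invOneSubExp_im, invOneSubExp_im, invOneSubExp, invOneSubExp]
    push_cast
    ring
  rw [e, norm_mul, Complex.norm_I, mul_one, Complex.norm_real, Real.norm_of_nonneg key]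

/-- With `b n = 1 / (1 - exp (2πi (f (n + 1) - f n)))`, each term equals `b n` times the difference
of consecutive exponentials. Summation by parts leaves two boundary terms and the variation of `b`,
which telescopes because the increments are monotone. -/
theorem kusminLandau_aux {f : ℕ → ℝ} {θ : ℝ} (hθ : 0 < θ) (L : ℕ)
    (h1 : ∀ n < L, θ ≤ f (n + 1) - f n) (h2 : ∀ n < L, f (n + 1) - f n ≤ 1 - θ)
    (h3 : ∀ n, n + 1 < L → f (n + 2) - f (n + 1) ≤ f (n + 1) - f n) :
    ‖∑ n ∈ Finset.range L, expTwoPi (f n)‖ ≤ 1 / θ := by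
  rcases L with _ | L
  · simp; positivity
  set b : ℕ → ℂ := fun n => invOneSubExp (f (n + 1) - f n) with hb
  have hstep : ∀ n < L + 1, expTwoPi (f n) + expTwoPi (f (n + 1)) * b n = expTwoPi (f n) * b n := by
    intro n hn
    have hs : Real.sin (Real.pi * (f (n + 1) - f n)) ≠ 0 := by
      have := two_mul_le_sin_pi_mul hθ (h1 n hn) (h2 n hn)
      linarith
    have := invOneSubExp_mul hs
    have e : expTwoPi (f (n + 1)) = expTwoPi (f n) * expTwoPi (f (n + 1) - f n) := by
      rw [← expTwoPi_add]; congr 1; ring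
    rw [e]
    linear_combination -expTwoPi (f n) * this
  have key : ∀ M ≤ L, ‖∑ n ∈ Finset.range (M + 1), expTwoPi (f n) + expTwoPi (f (M + 1)) * b M‖ ≤
      ‖b 0‖ + ((b M).im - (b 0).im) := by
    intro M
    induction M with
    | zero =>
      intro _
      simp only [zero_add, Finset.sum_range_one]
      rw [hstep 0 (by omega), norm_mul, norm_expTwoPi]
      simp
    | succ M ih =>
      intro hM
      have h := ih (by omega)
      have e : ∑ n ∈ Finset.range (M + 1 + 1), expTwoPi (f n) + expTwoPi (f (M + 1 + 1)) * b (M + 1) =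
          (∑ n ∈ Finset.range (M + 1), expTwoPi (f n) + expTwoPi (f (M + 1)) * b M) +
            expTwoPi (f (M + 1)) * (b (M + 1) - b M) := by
        rw [Finset.sum_range_succ _ (M + 1)]
        linear_combination hstep (M + 1) (by omega)
      have hn : ‖b (M + 1) - b M‖ = (b (M + 1)).im - (b M).im := by
        apply norm_invOneSubExp_sub
        · linarith [h1 (M + 1) (by omega)]
        · exact h3 M (by omega)
        · linarith [h2 M (by omega)]
      rw [e]
      refine (norm_add_le _ _).trans ?_
      rw [norm_mul, norm_expTwoPi, hn]
      linarith
  have hL := key L le_rfl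
  have b0 : ‖b 0‖ ≤ 1 / (4 * θ) := norm_invOneSubExp_le hθ (h1 0 (by omega)) (h2 0 (by omega))
  have bL : ‖b L‖ ≤ 1 / (4 * θ) := norm_invOneSubExp_le hθ (h1 L (by omega)) (h2 L (by omega))
  have i0 := (abs_le.1 (Complex.abs_im_le_norm (b 0))).1
  have iL := (abs_le.1 (Complex.abs_im_le_norm (b L))).2
  -- Four quantities are each at most `1 / (4θ)`: the norms of `b 0` and `b L`, and the two
  -- imaginary parts bounding the variation.
  have e4 : 1 / θ = 4 * (1 / (4 * θ)) := by field_simp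
  have hfin := norm_sub_le (∑ n ∈ Finset.range (L + 1), expTwoPi (f n) + expTwoPi (f (L + 1)) * b L)
    (expTwoPi (f (L + 1)) * b L)
  rw [add_sub_cancel_right, norm_mul, norm_expTwoPi] at hfin
  linarith

/-- The Kusmin–Landau inequality. -/
theorem kusminLandau {f : ℕ → ℝ} {θ : ℝ} (hθ : 0 < θ) (m : ℤ) (a b : ℕ)
    (h1 : ∀ n ∈ Finset.Ico a b, m + θ ≤ f (n + 1) - f n)
    (h2 : ∀ n ∈ Finset.Ico a b, f (n + 1) - f n ≤ m + 1 - θ)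
    (h3 : ∀ n ∈ Finset.Ico a b, n + 1 < b → f (n + 2) - f (n + 1) ≤ f (n + 1) - f n) :
    ‖∑ n ∈ Finset.Ico a b, expTwoPi (f n)‖ ≤ 1 / θ := by
  rw [Finset.sum_Ico_eq_sum_range]
  -- Subtracting `m * n` leaves the terms unchanged and moves the increments into `[θ, 1 - θ]`.
  have e : ∀ n, expTwoPi (f (a + n)) = expTwoPi (f (a + n) - m * n) := by
    intro n
    rw [← expTwoPi_sub_int (f (a + n)) (m * n)]
    push_cast
    rfl
  simp_rw [e]
  apply kusminLandau_aux (f := fun n => f (a + n) - m * n) hθ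
  · intro n hn
    have := h1 (a + n) (by simp; omega)
    simp only [Nat.cast_add, Nat.cast_one, ← add_assoc]
    linarith
  · intro n hn
    have := h2 (a + n) (by simp; omega)
    simp only [Nat.cast_add, Nat.cast_one, ← add_assoc]
    linarith
  · intro n hn
    have := h3 (a + n) (by simp; omega) (by omega)
    simp only [Nat.cast_add, Nat.cast_one, Nat.cast_ofNat, ← add_assoc]
    linarith

/-! ### Exponential sums by the second-difference test -/

theorem exists_eq_Ico_of_ordConnected (s : Finset ℕ)
    (hs : ∀ i ∈ s, ∀ j ∈ s, ∀ k, i ≤ k → k ≤ j → k ∈ s) : ∃ a b, s = Finset.Ico a b := by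
  rcases s.eq_empty_or_nonempty with rfl | hne
  · exact ⟨0, 0, by simp⟩
  refine ⟨s.min' hne, s.max' hne + 1, ?_⟩
  ext k
  rw [Finset.mem_Ico]
  constructor
  · intro hk
    exact ⟨s.min'_le k hk, Nat.lt_succ_of_le (s.le_max' k hk)⟩
  · rintro ⟨h1, h2⟩
    exact hs _ (s.min'_mem hne) _ (s.max'_mem hne) k h1 (Nat.lt_succ_iff.1 h2)

theorem mul_sub_le_of_drop {g : ℕ → ℝ} {μ : ℝ} {L : ℕ}
    (hd : ∀ n, n + 1 < L → μ ≤ g n - g (n + 1)) (i j : ℕ) (hij : i ≤ j) (hj : j < L) :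
    μ * ((j : ℝ) - i) ≤ g i - g j := by
  induction j, hij using Nat.le_induction with
  | base => simp
  | succ j hij ih =>
    have := ih (by omega)
    have := hd j hj
    push_cast
    linarith

/-- From the first to the last index in `s`, `g` falls by at least `μ` per step but by at most `θ`
in all. -/
theorem card_le_of_drop {g : ℕ → ℝ} {μ θ α : ℝ} {L : ℕ} (hμ : 0 < μ) (hθ : 0 < θ)
    (hd : ∀ n, n + 1 < L → μ ≤ g n - g (n + 1)) (s : Finset ℕ) (hsL : ∀ n ∈ s, n < L)
    (h1 : ∀ n ∈ s, α ≤ g n) (h2 : ∀ n ∈ s, g n ≤ α + θ) : (s.card : ℝ) ≤ θ / μ + 1 := by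
  rcases s.eq_empty_or_nonempty with rfl | hne
  · simp; positivity
  have hc : s.card ≤ s.max' hne + 1 - s.min' hne := by
    rw [← Nat.card_Icc]
    apply Finset.card_le_card
    intro k hk
    exact Finset.mem_Icc.2 ⟨s.min'_le k hk, s.le_max' k hk⟩
  have hmm : s.min' hne ≤ s.max' hne := s.min'_le _ (s.max'_mem hne)
  have hc' : (s.card : ℝ) ≤ (s.max' hne : ℝ) + 1 - s.min' hne := by
    have : ((s.max' hne + 1 - s.min' hne : ℕ) : ℝ) = (s.max' hne : ℝ) + 1 - s.min' hne := by
      rw [Nat.cast_sub (by omega)]; push_cast; ring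
    rw [← this]
    exact_mod_cast hc
  have := mul_sub_le_of_drop hd _ _ hmm (hsL _ (s.max'_mem hne))
  have a1 := h1 _ (s.max'_mem hne)
  have a2 := h2 _ (s.min'_mem hne)
  have : (s.max' hne : ℝ) - s.min' hne ≤ θ / μ := by
    rw [le_div_iff₀ hμ]; linarith
  linarith

/-- A discrete van der Corput inequality. -/
theorem norm_sum_expTwoPi_le {f : ℕ → ℝ} {μ θ ξ : ℝ} {L k : ℕ} (hμ : 0 < μ) (hθ : 0 < θ)
    (hd : ∀ n, n + 1 < L → μ ≤ (f (n + 1) - f n) - (f (n + 2) - f (n + 1)))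
    (h1 : ∀ n < L, ξ ≤ f (n + 1) - f n) (h2 : ∀ n < L, f (n + 1) - f n ≤ ξ + k) :
    ‖∑ n ∈ Finset.range L, expTwoPi (f n)‖ ≤ (k + 1) * (1 / θ + 2 * (θ / μ + 1)) := by
  set g : ℕ → ℝ := fun n => f (n + 1) - f n with hg
  have hd' : ∀ n, n + 1 < L → μ ≤ g n - g (n + 1) := hd
  have hmono : ∀ i j, i ≤ j → j < L → g j ≤ g i := by
    intro i j hij hj
    have := mul_sub_le_of_drop hd' i j hij hj
    have h0 : (0 : ℝ) ≤ (j : ℝ) - i := by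
      have : (i : ℝ) ≤ j := by exact_mod_cast hij
      linarith
    nlinarith
  have hmaps : ∀ n ∈ Finset.range L, ⌊g n⌋ ∈ Finset.Icc ⌊ξ⌋ (⌊ξ⌋ + k) := by
    intro n hn
    have hn := Finset.mem_range.1 hn
    rw [Finset.mem_Icc]
    refine ⟨Int.floor_le_floor (h1 n hn), ?_⟩
    have := Int.floor_le_floor (h2 n hn)
    rwa [Int.floor_add_natCast] at this
  -- On the indices whose increment has integer part `m`, those with increment at distance at least
  -- `θ` from `m` and `m + 1` form an interval, where Kusmin–Landau applies. The rest are near one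
  -- of the two integers, hence few, and are counted trivially.
  have hfib : ∀ m : ℤ, ‖∑ n ∈ Finset.range L with ⌊g n⌋ = m, expTwoPi (f n)‖ ≤
      1 / θ + 2 * (θ / μ + 1) := by
    intro m
    set s := (Finset.range L).filter (fun n => ⌊g n⌋ = m) with hs
    rw [← Finset.sum_filter_add_sum_filter_not s (fun n => m + θ ≤ g n ∧ g n ≤ m + 1 - θ)]
    refine (norm_add_le _ _).trans (add_le_add ?_ ?_)
    · obtain ⟨a, b, hab⟩ := exists_eq_Ico_of_ordConnected
        (s.filter (fun n => m + θ ≤ g n ∧ g n ≤ m + 1 - θ)) (by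
          intro i hi j hj k hik hkj
          simp only [hs, Finset.mem_filter, Finset.mem_range, Int.floor_eq_iff] at hi hj ⊢
          have q1 := hmono i k hik (by omega)
          have q2 := hmono k j hkj hj.1.1
          exact ⟨⟨by omega, by linarith, by linarith⟩, by linarith, by linarith⟩)
      rw [hab]
      have hmem : ∀ n ∈ Finset.Ico a b, n < L ∧ m + θ ≤ g n ∧ g n ≤ m + 1 - θ := by
        intro n hn
        rw [← hab] at hn
        simp only [hs, Finset.mem_filter, Finset.mem_range] at hn
        exact ⟨hn.1.1, hn.2⟩
      apply kusminLandau hθ m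
      · intro n hn; exact (hmem n hn).2.1
      · intro n hn; exact (hmem n hn).2.2
      · intro n hn hnb
        have : n + 1 ∈ Finset.Ico a b := by
          rw [Finset.mem_Ico] at hn ⊢; omega
        exact hmono n (n + 1) (by omega) (hmem _ this).1
    · have hsub : s.filter (fun n => ¬(m + θ ≤ g n ∧ g n ≤ m + 1 - θ)) ⊆
          (Finset.range L).filter (fun n => m ≤ g n ∧ g n ≤ m + θ) ∪
          (Finset.range L).filter (fun n => m + 1 - θ ≤ g n ∧ g n ≤ m + 1 - θ + θ) := by
        intro n hn
        simp only [hs, Finset.mem_filter, Finset.mem_range, Int.floor_eq_iff, Finset.mem_union] at hn ⊢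
        obtain ⟨⟨hL, h3, h4⟩, h5⟩ := hn
        by_cases h6 : m + θ ≤ g n
        · right
          have : ¬ (g n ≤ m + 1 - θ) := fun h => h5 ⟨h6, h⟩
          exact ⟨hL, by linarith, by linarith⟩
        · left
          exact ⟨hL, h3, by linarith⟩
      have c1 : (((Finset.range L).filter (fun n => m ≤ g n ∧ g n ≤ m + θ)).card : ℝ) ≤ θ / μ + 1 := by
        apply card_le_of_drop (α := m) hμ hθ hd'
        · intro n hn; simp at hn; exact hn.1
        · intro n hn; simp at hn; exact hn.2.1
        · intro n hn; simp at hn; exact hn.2.2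
      have c2 : (((Finset.range L).filter
          (fun n => m + 1 - θ ≤ g n ∧ g n ≤ m + 1 - θ + θ)).card : ℝ) ≤ θ / μ + 1 := by
        apply card_le_of_drop (α := m + 1 - θ) hμ hθ hd'
        · intro n hn; rw [Finset.mem_filter, Finset.mem_range] at hn; exact hn.1
        · intro n hn; rw [Finset.mem_filter] at hn; exact hn.2.1
        · intro n hn; rw [Finset.mem_filter] at hn; exact hn.2.2
      have c3 := (Finset.card_le_card hsub).trans (Finset.card_union_le _ _)
      have c4 : ((s.filter (fun n => ¬(m + θ ≤ g n ∧ g n ≤ m + 1 - θ))).card : ℝ) ≤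
        2 * (θ / μ + 1) := by
        have := (Nat.cast_le (α := ℝ)).2 c3
        push_cast at this
        linarith
      refine le_trans ?_ c4
      refine (norm_sum_le _ _).trans ?_
      simp [norm_expTwoPi]
  rw [← Finset.sum_fiberwise_of_maps_to hmaps]
  refine (norm_sum_le _ _).trans ?_
  refine (Finset.sum_le_sum fun m _ => hfib m).trans ?_
  rw [Finset.sum_const, nsmul_eq_mul, Int.card_Icc]
  have : (⌊ξ⌋ + (k : ℤ) + 1 - ⌊ξ⌋).toNat = k + 1 := by omega
  rw [this]
  push_cast
  exact le_rfl

/-- Exponential sums along `ξ n + k x n` for a sequence `x` with increments in `[0, 1]` that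
decrease by at least `lam` in each step. -/
theorem norm_sum_expTwoPi_mul_le {x : ℕ → ℝ} {lam : ℝ} {L k : ℕ} (hl : 0 < lam) (hl1 : lam ≤ 1)
    (hk : 1 ≤ k)
    (hd : ∀ n, n + 1 < L → lam ≤ (x (n + 1) - x n) - (x (n + 2) - x (n + 1)))
    (h1 : ∀ n < L, 0 ≤ x (n + 1) - x n) (h2 : ∀ n < L, x (n + 1) - x n ≤ 1) (ξ β : ℝ) :
    ‖∑ n ∈ Finset.range L, expTwoPi (ξ * n + k * x n + β)‖ ≤ 10 * (Real.sqrt k / Real.sqrt lam) := by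
  have hk' : (1 : ℝ) ≤ k := by exact_mod_cast hk
  have hsk : 1 ≤ Real.sqrt k := by rw [Real.one_le_sqrt]; exact hk'
  have hsl : 0 < Real.sqrt lam := Real.sqrt_pos.2 hl
  have qk : Real.sqrt k * Real.sqrt k = k := Real.mul_self_sqrt (by linarith)
  have ql : Real.sqrt lam * Real.sqrt lam = lam := Real.mul_self_sqrt hl.le
  rcases le_total (k * lam) 1 with hkl | hkl
  -- The choice `θ = √(k lam)` balances `1 / θ` against `θ / (k lam)`.
  · have hθ : 0 < Real.sqrt k * Real.sqrt lam := by positivity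
    have hθ1 : Real.sqrt k * Real.sqrt lam ≤ 1 := by
      rw [← Real.sqrt_mul (by linarith)]
      exact Real.sqrt_le_one.2 hkl
    have := norm_sum_expTwoPi_le (f := fun n : ℕ => ξ * n + k * x n + β) (μ := k * lam)
      (θ := Real.sqrt k * Real.sqrt lam) (ξ := ξ) (L := L) (k := k) (by positivity) hθ ?_ ?_ ?_
    · refine this.trans ?_
      have e : Real.sqrt k * Real.sqrt lam / (k * lam) = 1 / (Real.sqrt k * Real.sqrt lam) := by
        rw [div_eq_div_iff (by positivity) hθ.ne']
        linear_combination lam * qk + Real.sqrt k * Real.sqrt k * ql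
      rw [e]
      have i1 : 1 ≤ 1 / (Real.sqrt k * Real.sqrt lam) := by
        rw [le_div_iff₀ hθ]; linarith
      have e2 : Real.sqrt k / Real.sqrt lam = k * (1 / (Real.sqrt k * Real.sqrt lam)) := by
        field_simp
        linarith
      rw [e2]
      nlinarith
    · intro n hn
      have := hd n hn
      push_cast
      nlinarith
    · intro n hn
      have := h1 n hn
      push_cast
      nlinarith
    · intro n hn
      have := h2 n hn
      push_cast
      nlinarith
  -- For `k * lam ≥ 1` the trivial bound suffices: increments in `[0, 1]` that drop by `lam` each
  -- time can only persist for `2 / lam` steps.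
  · have hL : (L : ℝ) ≤ 2 / lam := by
      rcases L with _ | L
      · simp; positivity
      have := mul_sub_le_of_drop (g := fun n => x (n + 1) - x n) (μ := lam) (L := L + 1) hd 0 L
        (by omega) (by omega)
      have a1 := h2 0 (by omega)
      have a2 := h1 L (by omega)
      rw [le_div_iff₀ hl]
      push_cast at this ⊢
      simp only [zero_add] at this a1
      nlinarith
    have : ‖∑ n ∈ Finset.range L, expTwoPi (ξ * n + k * x n + β)‖ ≤ L := by
      refine (norm_sum_le _ _).trans ?_
      simp [norm_expTwoPi]
    have h3 : 1 ≤ Real.sqrt k * Real.sqrt lam := by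
      rw [← Real.sqrt_mul (by linarith)]
      exact Real.one_le_sqrt.2 hkl
    have h4 : 2 / lam ≤ 10 * (Real.sqrt k / Real.sqrt lam) := by
      have e : 10 * (Real.sqrt k / Real.sqrt lam) * lam = 10 * (Real.sqrt k * Real.sqrt lam) := by
        field_simp
        rw [sq, ql]
      rw [div_le_iff₀ hl, e]
      linarith
    linarith

/-! ### From exponential sums to sawtooth sums -/

/-- Summation by parts against the Fejér weights. -/
theorem sum_sub_mul_eq (a : ℕ → ℂ) (L : ℕ) :
    ∑ n ∈ Finset.range L, ((L : ℂ) - n) * a n =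
      ∑ M ∈ Finset.range L, ∑ n ∈ Finset.range (M + 1), a n := by
  induction L with
  | zero => simp
  | succ L ih =>
    rw [Finset.sum_range_succ (fun M => ∑ n ∈ Finset.range (M + 1), a n), ← ih, ← sub_eq_iff_eq_add',
      Finset.sum_range_succ, Finset.sum_range_succ a, add_sub_right_comm, ← Finset.sum_sub_distrib]
    congr 1
    · apply Finset.sum_congr rfl
      intro n _
      push_cast
      ring
    · push_cast; ring

theorem norm_sum_sub_mul_le (a : ℕ → ℂ) (L : ℕ) (B : ℝ)
    (hB : ∀ M ≤ L, ‖∑ n ∈ Finset.range M, a n‖ ≤ B) :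
    ‖∑ n ∈ Finset.range L, ((L : ℂ) - n) * a n‖ ≤ L * B := by
  rw [sum_sub_mul_eq]
  refine (norm_sum_le _ _).trans ?_
  refine (Finset.sum_le_sum (g := fun _ => B) fun M hM => ?_).trans ?_
  · exact hB (M + 1) (Finset.mem_range.1 hM)
  · simp

/-- The quadratic polynomial `x² - x + 1/6` at the fractional part. -/
noncomputable def fractB2 (x : ℝ) : ℝ := Int.fract x ^ 2 - Int.fract x + 1 / 6

theorem hasSum_fractB2 (x : ℝ) :
    HasSum (fun k : ℕ => 1 / (k : ℝ) ^ 2 * Real.cos (2 * Real.pi * k * x)) (Real.pi ^ 2 * fractB2 x) := by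
  have h := hasSum_one_div_nat_pow_mul_cos (k := 1) one_ne_zero (x := Int.fract x)
    ⟨Int.fract_nonneg x, (Int.fract_lt_one x).le⟩
  have e : ((-1 : ℝ) ^ (1 + 1) * (2 * Real.pi) ^ (2 * 1) / 2 / (2 * 1).factorial *
      ((Polynomial.bernoulli (2 * 1)).map (algebraMap ℚ ℝ)).eval (Int.fract x)) =
      Real.pi ^ 2 * fractB2 x := by
    rw [mul_one]
    simp [fractB2, Nat.factorial, Polynomial.bernoulli, Finset.sum_range_succ, bernoulli_two]
    ring
  rw [e] at h
  convert h using 2 with k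
  · congr 1
    rw [show 2 * Real.pi * k * x = 2 * Real.pi * k * Int.fract x + ((k : ℤ) * ⌊x⌋ : ℤ) * (2 * Real.pi) by
      conv_lhs => rw [← Int.floor_add_fract x]
      push_cast
      ring, Real.cos_add_int_mul_two_pi]

/-- The Fourier coefficients `1 / k ^ 2` absorb the growth `√k` and leave the convergent series of
`k ^ (-3 / 2)`. -/
theorem abs_sum_mul_fractB2_le {w x : ℕ → ℝ} {L : ℕ} {B : ℝ}
    (hB : ∀ k : ℕ, 1 ≤ k →
      |∑ n ∈ Finset.range L, w n * Real.cos (2 * Real.pi * (k * x n))| ≤ B * Real.sqrt k) :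
    |∑ n ∈ Finset.range L, w n * fractB2 (x n)| ≤ B * ∑' k : ℕ, 1 / (k : ℝ) ^ (3 / 2 : ℝ) := by
  have hs : Summable (fun k : ℕ => 1 / (k : ℝ) ^ (3 / 2 : ℝ)) :=
    Real.summable_one_div_nat_rpow.2 (by norm_num)
  have hB0 : 0 ≤ B := by
    have := (abs_nonneg _).trans (hB 1 le_rfl)
    simpa using this
  have h1 : HasSum (fun k : ℕ => ∑ n ∈ Finset.range L,
      w n * (1 / (k : ℝ) ^ 2 * Real.cos (2 * Real.pi * k * x n)))
      (∑ n ∈ Finset.range L, w n * (Real.pi ^ 2 * fractB2 (x n))) :=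
    hasSum_sum fun n _ => (hasSum_fractB2 (x n)).mul_left (w n)
  have h2 := h1.norm_le_of_bounded (hs.mul_left B).hasSum (fun k => by
    rcases Nat.eq_zero_or_pos k with rfl | hk
    · simp
    have hk' : (0 : ℝ) < k := by exact_mod_cast hk
    have e : ∑ n ∈ Finset.range L, w n * (1 / (k : ℝ) ^ 2 * Real.cos (2 * Real.pi * k * x n)) =
        1 / (k : ℝ) ^ 2 * ∑ n ∈ Finset.range L, w n * Real.cos (2 * Real.pi * (k * x n)) := by
      rw [Finset.mul_sum]
      apply Finset.sum_congr rfl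
      intro n _
      rw [mul_assoc (2 * Real.pi)]
      ring
    rw [e, norm_mul, Real.norm_of_nonneg (by positivity)]
    refine (mul_le_mul_of_nonneg_left (hB k hk) (by positivity)).trans (le_of_eq ?_)
    have : (k : ℝ) ^ 2 = (k : ℝ) ^ (3 / 2 : ℝ) * Real.sqrt k := by
      rw [Real.sqrt_eq_rpow, ← Real.rpow_add hk', ← Real.rpow_natCast]
      norm_num
    have hsk : 0 < Real.sqrt k := Real.sqrt_pos.2 hk'
    rw [this]
    field_simp)
  have e : ∑ n ∈ Finset.range L, w n * (Real.pi ^ 2 * fractB2 (x n)) =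
      Real.pi ^ 2 * ∑ n ∈ Finset.range L, w n * fractB2 (x n) := by
    rw [Finset.mul_sum]
    apply Finset.sum_congr rfl
    intro n _
    ring
  rw [e, norm_mul, Real.norm_of_nonneg (by positivity), Real.norm_eq_abs, tsum_mul_left] at h2
  have hp : 1 ≤ Real.pi ^ 2 := by nlinarith [Real.pi_gt_three]
  nlinarith [abs_nonneg (∑ n ∈ Finset.range L, w n * fractB2 (x n))]

/-- The right side is the squared modulus of `∑ exp (i j y)`; the left side is the square of its
real part. -/
theorem sq_sum_cos_le (K : ℕ) (y : ℝ) :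
    (∑ j ∈ Finset.range K, Real.cos (j * y)) ^ 2 ≤
      ∑ j ∈ Finset.range K, ∑ l ∈ Finset.range K, Real.cos (((j : ℝ) - l) * y) := by
  have e : ∑ j ∈ Finset.range K, ∑ l ∈ Finset.range K, Real.cos (((j : ℝ) - l) * y) =
      (∑ j ∈ Finset.range K, Real.cos (j * y)) ^ 2 + (∑ j ∈ Finset.range K, Real.sin (j * y)) ^ 2 := by
    rw [sq, sq, Finset.sum_mul_sum, Finset.sum_mul_sum, ← Finset.sum_add_distrib]
    apply Finset.sum_congr rfl
    intro j _
    rw [← Finset.sum_add_distrib]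
    apply Finset.sum_congr rfl
    intro l _
    rw [sub_mul, Real.cos_sub]
  rw [e]
  nlinarith [sq_nonneg (∑ j ∈ Finset.range K, Real.sin (j * y))]

theorem half_le_sum_cos {K : ℕ} (hK : 1 ≤ K) {x : ℝ} (hx : 1 - 1 / (8 * (K : ℝ)) ≤ Int.fract x) :
    (K : ℝ) / 2 ≤ ∑ j ∈ Finset.range K, Real.cos (j * (2 * Real.pi * x)) := by
  have hK' : (1 : ℝ) ≤ K := by exact_mod_cast hK
  have : ∀ j ∈ Finset.range K, (1 / 2 : ℝ) ≤ Real.cos (j * (2 * Real.pi * x)) := by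
    intro j hj
    have hj : (j : ℝ) ≤ K := by exact_mod_cast (Finset.mem_range.1 hj).le
    have hf := (Int.fract_lt_one x).le
    have e : (j : ℝ) * (2 * Real.pi * x) =
        -(2 * Real.pi * (j * (1 - Int.fract x))) + ((j : ℤ) * (⌊x⌋ + 1) : ℤ) * (2 * Real.pi) := by
      have := Int.floor_add_fract x
      push_cast
      linear_combination -(j * (2 * Real.pi)) * this
    rw [e, Real.cos_add_int_mul_two_pi, Real.cos_neg]
    refine le_trans ?_ (Real.one_sub_sq_div_two_le_cos)
    have h0 : 0 ≤ (j : ℝ) * (1 - Int.fract x) := mul_nonneg (Nat.cast_nonneg j) (by linarith)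
    have h1 : (j : ℝ) * (1 - Int.fract x) ≤ 1 / 8 := by
      calc (j : ℝ) * (1 - Int.fract x) ≤ K * (1 / (8 * (K : ℝ))) :=
            mul_le_mul hj (by linarith) (by linarith) (by linarith)
        _ = 1 / 8 := by field_simp
    have hp := Real.pi_lt_four
    have hp0 := Real.pi_pos
    have : 2 * Real.pi * (j * (1 - Int.fract x)) ≤ 1 := by nlinarith
    have : 0 ≤ 2 * Real.pi * (j * (1 - Int.fract x)) := by positivity
    nlinarith
  calc (K : ℝ) / 2 = ∑ j ∈ Finset.range K, (1 / 2 : ℝ) := by simp; ring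
    _ ≤ _ := Finset.sum_le_sum this

/-- Few terms of a sequence with small exponential sums lie just below an integer. -/
theorem card_fract_near_one_le {x : ℕ → ℝ} {L K : ℕ} (hK : 1 ≤ K) {B : ℝ}
    (hB : ∀ k : ℕ, 1 ≤ k →
      |∑ n ∈ Finset.range L, Real.cos (2 * Real.pi * (k * x n))| ≤ B * Real.sqrt k) :
    (((Finset.range L).filter (fun n => 1 - 1 / (8 * (K : ℝ)) ≤ Int.fract (x n))).card : ℝ) ≤
      4 * (L / K + B * K) := by
  have hK' : (1 : ℝ) ≤ K := by exact_mod_cast hK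
  have hB0 : 0 ≤ B := by
    have := (abs_nonneg _).trans (hB 1 le_rfl)
    simpa using this
  set s := (Finset.range L).filter (fun n => 1 - 1 / (8 * (K : ℝ)) ≤ Int.fract (x n)) with hs
  -- A Fejér-kernel majorant: each counted point contributes at least `(K / 2) ^ 2`. In the expanded
  -- double sum the diagonal gives `K * L`, and the other pairs are exponential sums of frequency
  -- below `K`.
  have h1 : (s.card : ℝ) * ((K : ℝ) / 2) ^ 2 ≤
      ∑ n ∈ Finset.range L, (∑ j ∈ Finset.range K, Real.cos (j * (2 * Real.pi * x n))) ^ 2 := by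
    calc (s.card : ℝ) * ((K : ℝ) / 2) ^ 2 = ∑ n ∈ s, ((K : ℝ) / 2) ^ 2 := by simp
      _ ≤ ∑ n ∈ s, (∑ j ∈ Finset.range K, Real.cos (j * (2 * Real.pi * x n))) ^ 2 := by
        apply Finset.sum_le_sum
        intro n hn
        exact pow_le_pow_left₀ (by positivity) (half_le_sum_cos hK (Finset.mem_filter.1 hn).2) 2
      _ ≤ _ := Finset.sum_le_sum_of_subset_of_nonneg (Finset.filter_subset _ _)
        (fun _ _ _ => sq_nonneg _)
  have h2 : ∑ n ∈ Finset.range L, (∑ j ∈ Finset.range K, Real.cos (j * (2 * Real.pi * x n))) ^ 2 ≤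
      ∑ j ∈ Finset.range K, ∑ l ∈ Finset.range K,
        ∑ n ∈ Finset.range L, Real.cos (((j : ℝ) - l) * (2 * Real.pi * x n)) := by
    refine (Finset.sum_le_sum fun n _ => sq_sum_cos_le K _).trans (le_of_eq ?_)
    rw [Finset.sum_comm]
    apply Finset.sum_congr rfl
    intro j _
    rw [Finset.sum_comm]
  have h3 : ∀ j ∈ Finset.range K, ∀ l ∈ Finset.range K,
      ∑ n ∈ Finset.range L, Real.cos (((j : ℝ) - l) * (2 * Real.pi * x n)) ≤
        (if j = l then (L : ℝ) else 0) + B * K := by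
    intro j hj l hl
    have hj := Finset.mem_range.1 hj
    have hl := Finset.mem_range.1 hl
    split_ifs with hjl
    · subst hjl
      simp
      positivity
    · have hle : ∀ i : ℕ, i < K → B * Real.sqrt i ≤ B * K := by
        intro i hi
        apply mul_le_mul_of_nonneg_left _ hB0
        rw [Real.sqrt_le_left (by linarith)]
        have : (i : ℝ) ≤ K := by exact_mod_cast hi.le
        nlinarith
      rw [zero_add]
      rcases lt_or_gt_of_ne hjl with h | h
      · refine le_trans ?_ ((le_abs_self _).trans ((hB (l - j) (by omega)).trans (hle _ (by omega))))
        apply le_of_eq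
        apply Finset.sum_congr rfl
        intro n _
        rw [← Real.cos_neg, Nat.cast_sub h.le]
        congr 1
        ring
      · refine le_trans ?_ ((le_abs_self _).trans ((hB (j - l) (by omega)).trans (hle _ (by omega))))
        apply le_of_eq
        apply Finset.sum_congr rfl
        intro n _
        rw [Nat.cast_sub h.le]
        congr 1
        ring
  have h4 : (s.card : ℝ) * ((K : ℝ) / 2) ^ 2 ≤ K * L + K ^ 2 * (B * K) := by
    refine h1.trans (h2.trans ((Finset.sum_le_sum fun j hj => Finset.sum_le_sum fun l hl =>
      h3 j hj l hl).trans (le_of_eq ?_)))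
    simp only [Finset.sum_add_distrib, Finset.sum_ite_eq, Finset.sum_const, Finset.card_range, nsmul_eq_mul]
    rw [Finset.sum_congr rfl (fun j hj => if_pos hj)]
    simp
    ring
  have e : 4 * ((L : ℝ) / K + B * K) * ((K : ℝ) / 2) ^ 2 = K * L + K ^ 2 * (B * K) := by
    field_simp
    ring
  rw [← e] at h4
  exact le_of_mul_le_mul_right h4 (by positivity)

/-- Since `fractB2 / 2` is an antiderivative of the sawtooth, its difference quotient is the
sawtooth plus `δ / 2` whenever `[x, x + δ]` meets no jump. Across a jump both quantities are at most
`1 / 2` in size. -/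
theorem abs_fract_sub_smooth_le (x : ℝ) {δ : ℝ} (h0 : 0 < δ) (h1 : δ ≤ 1) :
    |Int.fract x - 1 / 2 - (fractB2 (x + δ) - fractB2 x) / (2 * δ)| ≤
      δ + if 1 - δ ≤ Int.fract x then 1 else 0 := by
  have f0 := Int.fract_nonneg x
  have f1 := Int.fract_lt_one x
  have fx := Int.floor_add_fract x
  split_ifs with h
  · rcases lt_or_ge (Int.fract x + δ) 1 with h2 | h2
    · linarith
    have e : Int.fract (x + δ) = Int.fract x + δ - 1 := by
      rw [Int.fract_eq_iff]
      refine ⟨by linarith, by linarith, ⌊x⌋ + 1, ?_⟩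
      push_cast
      linarith
    have e2 : (fractB2 (x + δ) - fractB2 x) / (2 * δ) =
        (δ - 1) * (Int.fract x - 1 + δ / 2) / δ := by
      rw [fractB2, fractB2, e]
      field_simp
      ring
    have h3 : |(δ - 1) * (Int.fract x - 1 + δ / 2) / δ| ≤ 1 / 2 := by
      rw [abs_div, abs_mul, abs_of_pos h0, div_le_iff₀ h0]
      have a1 : |δ - 1| ≤ 1 := by rw [abs_le]; constructor <;> linarith
      have a2 : |Int.fract x - 1 + δ / 2| ≤ 1 / 2 * δ := by rw [abs_le]; constructor <;> linarith
      calc _ ≤ 1 * (1 / 2 * δ) := mul_le_mul a1 a2 (abs_nonneg _) zero_le_one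
        _ = _ := by ring
    have h4 : |Int.fract x - 1 / 2| ≤ 1 / 2 := by rw [abs_le]; constructor <;> linarith
    rw [e2]
    refine (abs_sub _ _).trans ?_
    linarith
  · have e : Int.fract (x + δ) = Int.fract x + δ := by
      rw [Int.fract_eq_iff]
      refine ⟨by linarith, by linarith, ⌊x⌋, ?_⟩
      linarith
    have e2 : (fractB2 (x + δ) - fractB2 x) / (2 * δ) = Int.fract x - 1 / 2 + δ / 2 := by
      rw [fractB2, fractB2, e]
      field_simp
      ring
    rw [e2, abs_le]
    constructor <;> linarith

/-- A weighted sum of the sawtooth function is controlled by exponential sums. -/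
theorem abs_sum_mul_sawtooth_le {w x : ℕ → ℝ} {L K : ℕ} (hK : 1 ≤ K) {B : ℝ}
    (hw : ∀ n < L, |w n| ≤ 1)
    (hB : ∀ k : ℕ, 1 ≤ k → ∀ β : ℝ,
      |∑ n ∈ Finset.range L, w n * Real.cos (2 * Real.pi * (k * x n + β))| ≤ B * Real.sqrt k)
    (hB1 : ∀ k : ℕ, 1 ≤ k →
      |∑ n ∈ Finset.range L, Real.cos (2 * Real.pi * (k * x n))| ≤ B * Real.sqrt k) :
    |∑ n ∈ Finset.range L, w n * (Int.fract (x n) - 1 / 2)| ≤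
      (5 + 8 * ∑' k : ℕ, 1 / (k : ℝ) ^ (3 / 2 : ℝ)) * (L / K + B * K) := by
  have hK' : (1 : ℝ) ≤ K := by exact_mod_cast hK
  have hB0 : 0 ≤ B := by
    have := (abs_nonneg _).trans (hB1 1 le_rfl)
    simpa using this
  set Z := ∑' k : ℕ, 1 / (k : ℝ) ^ (3 / 2 : ℝ) with hZ
  have hZ0 : 0 ≤ Z := tsum_nonneg fun k => by positivity
  -- This is the width for which `card_fract_near_one_le` counts the points near a jump.
  set δ : ℝ := 1 / (8 * (K : ℝ)) with hδ
  have hδ0 : 0 < δ := by positivity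
  have hδ1 : δ ≤ 1 := by rw [hδ, div_le_one (by positivity)]; linarith
  have hδ2 : δ ≤ 1 / K := one_div_le_one_div_of_le (by linarith) (by linarith)
  have s1 : |∑ n ∈ Finset.range L, w n * fractB2 (x n)| ≤ B * Z := by
    apply abs_sum_mul_fractB2_le
    intro k hk
    simpa using hB k hk 0
  -- The shift by `δ` becomes a constant phase `k * δ`, which is why `hB` allows an arbitrary `β`.
  have s2 : |∑ n ∈ Finset.range L, w n * fractB2 (x n + δ)| ≤ B * Z := by
    apply abs_sum_mul_fractB2_le (x := fun n => x n + δ)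
    intro k hk
    simpa [mul_add] using hB k hk (k * δ)
  have e : ∑ n ∈ Finset.range L, w n * (Int.fract (x n) - 1 / 2) =
      ∑ n ∈ Finset.range L, w n * (Int.fract (x n) - 1 / 2 -
        (fractB2 (x n + δ) - fractB2 (x n)) / (2 * δ)) +
      (∑ n ∈ Finset.range L, w n * fractB2 (x n + δ) -
        ∑ n ∈ Finset.range L, w n * fractB2 (x n)) / (2 * δ) := by
    rw [← Finset.sum_sub_distrib, Finset.sum_div, ← Finset.sum_add_distrib]
    apply Finset.sum_congr rfl
    intro n _
    ring
  have t1 : |∑ n ∈ Finset.range L, w n * (Int.fract (x n) - 1 / 2 -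
        (fractB2 (x n + δ) - fractB2 (x n)) / (2 * δ))| ≤ L * δ + 4 * (L / K + B * K) := by
    calc _ ≤ ∑ n ∈ Finset.range L, (δ + if 1 - δ ≤ Int.fract (x n) then 1 else 0) := by
          refine (Finset.abs_sum_le_sum_abs _ _).trans (Finset.sum_le_sum fun n hn => ?_)
          rw [abs_mul]
          refine (mul_le_mul (hw n (Finset.mem_range.1 hn))
            (abs_fract_sub_smooth_le (x n) hδ0 hδ1) (abs_nonneg _) zero_le_one).trans ?_
          rw [one_mul]
      _ = L * δ + (((Finset.range L).filter (fun n => 1 - δ ≤ Int.fract (x n))).card : ℝ) := by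
          rw [Finset.sum_add_distrib, Finset.sum_boole]
          simp
      _ ≤ _ := by
          have := card_fract_near_one_le (x := x) hK hB1
          linarith
  have t2 : |(∑ n ∈ Finset.range L, w n * fractB2 (x n + δ) -
        ∑ n ∈ Finset.range L, w n * fractB2 (x n)) / (2 * δ)| ≤ 8 * K * (B * Z) := by
    rw [abs_div, abs_of_pos (by positivity : 0 < 2 * δ), div_le_iff₀ (by positivity)]
    have e3 : 8 * K * (B * Z) * (2 * δ) = 2 * (B * Z) := by
      rw [hδ]
      field_simp
    rw [e3]
    refine (abs_sub _ _).trans ?_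
    linarith
  rw [e]
  refine (abs_add_le _ _).trans ((add_le_add t1 t2).trans ?_)
  have a1 : (L : ℝ) * δ ≤ L / K := by
    rw [div_eq_mul_one_div]
    exact mul_le_mul_of_nonneg_left hδ2 (Nat.cast_nonneg L)
  have a2 : 0 ≤ Z * (L / K) := by positivity
  have a3 : 0 ≤ B * K := by positivity
  nlinarith

/-- The case of Fejér weights twisted by a cosine. -/
theorem abs_sum_fejer_sawtooth_le {x : ℕ → ℝ} {lam ξ : ℝ} {n₀ N K : ℕ} (hN : n₀ ≤ N) (hN1 : 1 ≤ N)
    (hK : 1 ≤ K) (hl : 0 < lam) (hl1 : lam ≤ 1)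
    (hd : ∀ n, n₀ ≤ n → n + 1 < N → lam ≤ (x (n + 1) - x n) - (x (n + 2) - x (n + 1)))
    (h1 : ∀ n, n₀ ≤ n → n < N → 0 ≤ x (n + 1) - x n)
    (h2 : ∀ n, n₀ ≤ n → n < N → x (n + 1) - x n ≤ 1) :
    |∑ n ∈ Finset.Ico n₀ N, (1 - (n : ℝ) / N) * Real.cos (2 * Real.pi * (ξ * n)) *
      (Int.fract (-x n) - 1 / 2)| ≤
      (5 + 8 * ∑' k : ℕ, 1 / (k : ℝ) ^ (3 / 2 : ℝ)) * (N / K + 10 / Real.sqrt lam * K) := by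
  have hN' : (1 : ℝ) ≤ N := by exact_mod_cast hN1
  have hK' : (1 : ℝ) ≤ K := by exact_mod_cast hK
  obtain ⟨L, rfl⟩ := Nat.exists_eq_add_of_le hN
  have hT : ∀ k : ℕ, 1 ≤ k → ∀ ξ β : ℝ, ∀ M ≤ L,
      ‖∑ n ∈ Finset.range M, expTwoPi (ξ * n + k * x (n₀ + n) + β)‖ ≤
        10 * (Real.sqrt k / Real.sqrt lam) := by
    intro k hk ξ β M hM
    apply norm_sum_expTwoPi_mul_le (x := fun n => x (n₀ + n)) hl hl1 hk
    · intro n hn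
      exact hd (n₀ + n) (by omega) (by omega)
    · intro n hn
      exact h1 (n₀ + n) (by omega) (by omega)
    · intro n hn
      exact h2 (n₀ + n) (by omega) (by omega)
  have hC : ∀ k : ℕ, 1 ≤ k → ∀ ξ β : ℝ,
      |∑ n ∈ Finset.range L, (1 - ((n₀ + n : ℕ) : ℝ) / (n₀ + L : ℕ)) *
        Real.cos (2 * Real.pi * (ξ * n + k * x (n₀ + n) + β))| ≤
        10 * (Real.sqrt k / Real.sqrt lam) := by
    intro k hk ξ β
    have := norm_sum_sub_mul_le (fun n => expTwoPi (ξ * n + k * x (n₀ + n) + β)) L _ (hT k hk ξ β)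
    have h5 := (Complex.abs_re_le_norm _).trans this
    -- Since `N = n₀ + L`, the weight is `(L - n) / N`. Summation by parts gains a factor `L`, which
    -- the division by `N` cancels.
    have e : ∑ n ∈ Finset.range L, (1 - ((n₀ + n : ℕ) : ℝ) / (n₀ + L : ℕ)) *
        Real.cos (2 * Real.pi * (ξ * n + k * x (n₀ + n) + β)) = 1 / ((n₀ + L : ℕ) : ℝ) *
        (∑ n ∈ Finset.range L, ((L : ℂ) - n) * expTwoPi (ξ * n + k * x (n₀ + n) + β)).re := by
      rw [Complex.re_sum, Finset.mul_sum]
      apply Finset.sum_congr rfl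
      intro n _
      rw [← expTwoPi_re]
      have : ((L : ℂ) - n) = ((L - n : ℝ) : ℂ) := by push_cast; rfl
      rw [this, Complex.re_ofReal_mul]
      field_simp
      push_cast
      ring
    rw [e, abs_mul, abs_of_nonneg (by positivity), one_div_mul_eq_div, div_le_iff₀ (by linarith)]
    refine h5.trans ?_
    rw [mul_comm]
    apply mul_le_mul_of_nonneg_left _ (by positivity)
    push_cast
    linarith [Nat.cast_nonneg (α := ℝ) n₀]
  rw [Finset.sum_Ico_eq_sum_range, Nat.add_sub_cancel_left]
  refine (abs_sum_mul_sawtooth_le (B := 10 / Real.sqrt lam) hK ?_ ?_ ?_).trans ?_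
  · intro n hn
    rw [abs_mul]
    refine mul_le_one₀ ?_ (abs_nonneg _) (Real.abs_cos_le_one _)
    have : ((n₀ + n : ℕ) : ℝ) ≤ (n₀ + L : ℕ) := by exact_mod_cast (by omega)
    have q0 : 0 ≤ ((n₀ + n : ℕ) : ℝ) / (n₀ + L : ℕ) := by positivity
    have q1 : ((n₀ + n : ℕ) : ℝ) / (n₀ + L : ℕ) ≤ 1 := div_le_one_of_le₀ this (by positivity)
    rw [abs_le]
    constructor <;> linarith
  · intro k hk β
    -- The product of the twist and the harmonic splits into two cosines with frequencies `ξ` and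
    -- `-ξ`; the bound holds uniformly in the frequency.
    have p1 := hC k hk ξ (ξ * n₀ - β)
    have p2 := hC k hk (-ξ) (-(ξ * n₀) - β)
    have e : ∑ n ∈ Finset.range L, (1 - ((n₀ + n : ℕ) : ℝ) / (n₀ + L : ℕ)) *
        Real.cos (2 * Real.pi * (ξ * (n₀ + n : ℕ))) * Real.cos (2 * Real.pi * (k * -x (n₀ + n) + β)) =
        1 / 2 * (∑ n ∈ Finset.range L, (1 - ((n₀ + n : ℕ) : ℝ) / (n₀ + L : ℕ)) *
          Real.cos (2 * Real.pi * (ξ * n + k * x (n₀ + n) + (ξ * n₀ - β))) +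
        ∑ n ∈ Finset.range L, (1 - ((n₀ + n : ℕ) : ℝ) / (n₀ + L : ℕ)) *
          Real.cos (2 * Real.pi * (-ξ * n + k * x (n₀ + n) + (-(ξ * n₀) - β)))) := by
      rw [← Finset.sum_add_distrib, Finset.mul_sum]
      apply Finset.sum_congr rfl
      intro n _
      have e1 : 2 * Real.pi * (ξ * n + k * x (n₀ + n) + (ξ * n₀ - β)) =
          2 * Real.pi * (ξ * (n₀ + n : ℕ)) - 2 * Real.pi * (k * -x (n₀ + n) + β) := by
        push_cast; ring
      have e2 : 2 * Real.pi * (-ξ * n + k * x (n₀ + n) + (-(ξ * n₀) - β)) =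
          -(2 * Real.pi * (ξ * (n₀ + n : ℕ)) + 2 * Real.pi * (k * -x (n₀ + n) + β)) := by
        push_cast; ring
      rw [e1, e2, Real.cos_neg, Real.cos_add, Real.cos_sub]
      ring
    rw [e, abs_mul, abs_of_pos (by norm_num)]
    have := abs_add_le (∑ n ∈ Finset.range L, (1 - ((n₀ + n : ℕ) : ℝ) / (n₀ + L : ℕ)) *
          Real.cos (2 * Real.pi * (ξ * n + k * x (n₀ + n) + (ξ * n₀ - β))))
        (∑ n ∈ Finset.range L, (1 - ((n₀ + n : ℕ) : ℝ) / (n₀ + L : ℕ)) *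
          Real.cos (2 * Real.pi * (-ξ * n + k * x (n₀ + n) + (-(ξ * n₀) - β))))
    have e3 : 10 / Real.sqrt lam * Real.sqrt k = 10 * (Real.sqrt k / Real.sqrt lam) := by ring
    rw [e3]
    linarith
  · intro k hk
    have := (Complex.abs_re_le_norm _).trans (hT k hk 0 0 L le_rfl)
    rw [Complex.re_sum] at this
    have e3 : 10 / Real.sqrt lam * Real.sqrt k = 10 * (Real.sqrt k / Real.sqrt lam) := by ring
    rw [e3]
    refine le_of_eq_of_le (congrArg _ (Finset.sum_congr rfl fun n _ => ?_)) this
    rw [expTwoPi_re, ← Real.cos_neg]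
    congr 1
    ring
  · have hZ0 : 0 ≤ ∑' k : ℕ, 1 / (k : ℝ) ^ (3 / 2 : ℝ) := tsum_nonneg fun k => by positivity
    apply mul_le_mul_of_nonneg_left _ (by positivity)
    gcongr
    omega

/-! ### Cosine sums with convex coefficients -/

theorem sum_mul_cos_abel (w : ℕ → ℝ) (y : ℝ) (N : ℕ) :
    w 0 / 2 + ∑ n ∈ Finset.range N, w (n + 1) * Real.cos ((n + 1 : ℕ) * y) =
      ∑ n ∈ Finset.range N, (w n - w (n + 1)) *
        (1 / 2 + ∑ j ∈ Finset.range n, Real.cos ((j + 1 : ℕ) * y)) +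
      w N * (1 / 2 + ∑ j ∈ Finset.range N, Real.cos ((j + 1 : ℕ) * y)) := by
  induction N with
  | zero => simp; ring
  | succ N ih =>
    rw [Finset.sum_range_succ, ← add_assoc, ih, Finset.sum_range_succ _ N, Finset.sum_range_succ _ N]
    ring

/-- Summed Dirichlet kernels form the Fejér kernel, a squared modulus and so nonnegative. Adding the
term `j = N` to the exponential sum raises its squared modulus by twice the `N`-th Dirichlet kernel.
-/
theorem two_mul_sum_dirichlet (y : ℝ) (N : ℕ) :
    2 * ∑ n ∈ Finset.range N, (1 / 2 + ∑ j ∈ Finset.range n, Real.cos ((j + 1 : ℕ) * y)) =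
      (∑ j ∈ Finset.range N, Real.cos (j * y)) ^ 2 + (∑ j ∈ Finset.range N, Real.sin (j * y)) ^ 2 := by
  induction N with
  | zero => simp
  | succ N ih =>
    have e : ∑ j ∈ Finset.range N, Real.cos ((j + 1 : ℕ) * y) =
        Real.cos (N * y) * ∑ j ∈ Finset.range N, Real.cos (j * y) +
        Real.sin (N * y) * ∑ j ∈ Finset.range N, Real.sin (j * y) := by
      rw [← Finset.sum_range_reflect, Finset.mul_sum, Finset.mul_sum, ← Finset.sum_add_distrib]
      apply Finset.sum_congr rfl
      intro j hj
      have hj := Finset.mem_range.1 hj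
      rw [← Real.cos_sub, show N - 1 - j + 1 = N - j by omega, Nat.cast_sub hj.le]
      congr 1
      ring
    rw [Finset.sum_range_succ, mul_add, ih, e, Finset.sum_range_succ, Finset.sum_range_succ]
    nlinarith [Real.sin_sq_add_cos_sq (N * y)]

/-- Cosine sums with convex coefficients vanishing at `N` are bounded below. -/
theorem neg_half_le_sum_convex_mul_cos {w : ℕ → ℝ} {N : ℕ} (hw : w N = 0) (hw' : w (N + 1) = 0)
    (hc : ∀ n < N, 0 ≤ (w n - w (n + 1)) - (w (n + 1) - w (n + 2))) (y : ℝ) :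
    -(w 0 / 2) ≤ ∑ n ∈ Finset.range N, w (n + 1) * Real.cos ((n + 1 : ℕ) * y) := by
  set D : ℕ → ℝ := fun n => 1 / 2 + ∑ j ∈ Finset.range n, Real.cos ((j + 1 : ℕ) * y) with hD
  have hK : ∀ M, 0 ≤ ∑ n ∈ Finset.range M, D n := by
    intro M
    have := two_mul_sum_dirichlet y M
    nlinarith [sq_nonneg (∑ j ∈ Finset.range M, Real.cos (j * y)),
      sq_nonneg (∑ j ∈ Finset.range M, Real.sin (j * y))]
  -- The second summation by parts replaces Dirichlet kernels by Fejér kernels and first differences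
  -- of `w` by second differences; both are nonnegative. The boundary terms vanish because `w` is
  -- zero at `N` and `N + 1`.
  have e2 : ∀ M, ∑ n ∈ Finset.range M, (w n - w (n + 1)) * D n =
      ∑ n ∈ Finset.range M, ((w n - w (n + 1)) - (w (n + 1) - w (n + 2))) *
        ∑ j ∈ Finset.range (n + 1), D j + (w M - w (M + 1)) * ∑ j ∈ Finset.range M, D j := by
    intro M
    induction M with
    | zero => simp
    | succ M ih =>
      rw [Finset.sum_range_succ, ih, Finset.sum_range_succ _ M, Finset.sum_range_succ D M]
      ring
  have h1 := sum_mul_cos_abel w y N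
  have h2 := e2 N
  rw [hw, hw', sub_zero, zero_mul, add_zero] at h2
  rw [hw, zero_mul, add_zero] at h1
  have h3 : 0 ≤ ∑ n ∈ Finset.range N, ((w n - w (n + 1)) - (w (n + 1) - w (n + 2))) *
        ∑ j ∈ Finset.range (n + 1), D j := by
    apply Finset.sum_nonneg
    intro n hn
    exact mul_nonneg (hc n (Finset.mem_range.1 hn)) (hK _)
  linarith

/-! ### Eventual signs in a Hardy field -/

variable {H : Subring (Germ (atTop : Filter ℝ) ℝ)}

theorem IsHardyField.eventually_contDiffAt (hH : IsHardyField H) {f : ℝ → ℝ}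
    (hf : (f : Germ (atTop : Filter ℝ) ℝ) ∈ H) : ∀ᶠ t in atTop, ContDiffAt ℝ ∞ f t := by
  obtain ⟨g, u, hg, hfg⟩ := hH.le_smoothGerms hf
  obtain ⟨T, hT⟩ := eventually_atTop.1 (Germ.coe_eq.1 hfg)
  filter_upwards [eventually_gt_atTop T, eventually_gt_atTop u] with t ht hu
  refine (hg.contDiffAt (Ioi_mem_nhds hu)).congr_of_eventuallyEq ?_
  filter_upwards [Ioi_mem_nhds ht] with s hs
  exact hT s (le_of_lt hs)

theorem IsHardyField.eventually_differentiableAt (hH : IsHardyField H) {f : ℝ → ℝ}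
    (hf : (f : Germ (atTop : Filter ℝ) ℝ) ∈ H) : ∀ᶠ t in atTop, DifferentiableAt ℝ f t :=
  (hH.eventually_contDiffAt hf).mono fun _ ht => ht.differentiableAt (by simp)

theorem IsHardyField.deriv_mem' (hH : IsHardyField H) {f : ℝ → ℝ}
    (hf : (f : Germ (atTop : Filter ℝ) ℝ) ∈ H) : (deriv f : Germ (atTop : Filter ℝ) ℝ) ∈ H :=
  hH.deriv_mem _ hf

theorem IsHardyField.exists_inv (hH : IsHardyField H) {f : ℝ → ℝ}
    (hf : (f : Germ (atTop : Filter ℝ) ℝ) ∈ H) :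
    f =ᶠ[atTop] 0 ∨ ∃ g : ℝ → ℝ, (g : Germ (atTop : Filter ℝ) ℝ) ∈ H ∧ ∀ᶠ t in atTop, f t * g t = 1 := by
  by_cases h0 : (f : Germ (atTop : Filter ℝ) ℝ) = 0
  · left
    exact Germ.coe_eq.1 h0
  · right
    obtain ⟨⟨y, hy⟩, hfy⟩ := hH.isField.mul_inv_cancel
      (a := (⟨(f : Germ (atTop : Filter ℝ) ℝ), hf⟩ : H)) (fun h => h0 (congrArg Subtype.val h))
    induction y using Germ.inductionOn with
    | _ g =>
      refine ⟨g, hy, ?_⟩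
      have h1 : ((f * g : ℝ → ℝ) : Germ (atTop : Filter ℝ) ℝ) = ((1 : ℝ → ℝ) : Germ _ _) :=
        congrArg Subtype.val hfy
      exact Germ.coe_eq.1 h1

/-- A function whose germ lies in a Hardy field has a sign near infinity. -/
theorem IsHardyField.eventually_sign (hH : IsHardyField H) {f : ℝ → ℝ}
    (hf : (f : Germ (atTop : Filter ℝ) ℝ) ∈ H) :
    f =ᶠ[atTop] 0 ∨ (∀ᶠ t in atTop, 0 < f t) ∨ ∀ᶠ t in atTop, f t < 0 := by
  rcases hH.exists_inv hf with h | ⟨g, -, hg⟩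
  · exact Or.inl h
  right
  obtain ⟨T, hT⟩ := eventually_atTop.1 (hg.and (hH.eventually_differentiableAt hf))
  have hcont : ContinuousOn f (Set.Ici T) := fun t ht =>
    (hT t ht).2.continuousAt.continuousWithinAt
  -- An invertible germ has no zeros near infinity, so by the intermediate value theorem it cannot
  -- change sign.
  have hne : ∀ t ∈ Set.Ici T, f t ≠ 0 := fun t ht h0 => by
    have := (hT t ht).1
    rw [h0, zero_mul] at this
    exact zero_ne_one this
  rcases lt_or_gt_of_ne (hne T Set.self_mem_Ici) with h | h
  · right
    filter_upwards [eventually_ge_atTop T] with t ht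
    by_contra hcon
    obtain ⟨s, hs, hs0⟩ := isPreconnected_Ici.intermediate_value Set.self_mem_Ici ht hcont
      ⟨h.le, not_lt.1 hcon⟩
    exact hne s hs hs0
  · left
    filter_upwards [eventually_ge_atTop T] with t ht
    by_contra hcon
    obtain ⟨s, hs, hs0⟩ := isPreconnected_Ici.intermediate_value ht Set.self_mem_Ici hcont
      ⟨not_lt.1 hcon, h.le⟩
    exact hne s hs hs0

theorem monotoneOn_Ici_of_hasDerivAt {F F' : ℝ → ℝ} {T : ℝ}
    (hF : ∀ t, T ≤ t → HasDerivAt F (F' t) t) (h0 : ∀ t, T ≤ t → 0 ≤ F' t) :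
    MonotoneOn F (Set.Ici T) := by
  apply monotoneOn_of_deriv_nonneg (convex_Ici T)
  · exact fun t ht => (hF t ht).continuousAt.continuousWithinAt
  · rw [interior_Ici]
    exact fun t ht => (hF t (le_of_lt ht)).differentiableAt.differentiableWithinAt
  · rw [interior_Ici]
    intro t ht
    rw [(hF t (le_of_lt ht)).deriv]
    exact h0 t (le_of_lt ht)

theorem antitoneOn_Ici_of_hasDerivAt {F F' : ℝ → ℝ} {T : ℝ}
    (hF : ∀ t, T ≤ t → HasDerivAt F (F' t) t) (h0 : ∀ t, T ≤ t → F' t ≤ 0) :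
    AntitoneOn F (Set.Ici T) := by
  have := monotoneOn_Ici_of_hasDerivAt (F := fun t => -F t) (F' := fun t => -F' t)
    (fun t ht => (hF t ht).neg) (fun t ht => by linarith [h0 t ht])
  intro a ha b hb hab
  linarith [this ha hb hab]

theorem eventually_nonneg_or_nonpos_of_monotoneOn {F : ℝ → ℝ} {T : ℝ}
    (hF : MonotoneOn F (Set.Ici T)) : (∀ᶠ t in atTop, 0 ≤ F t) ∨ ∀ᶠ t in atTop, F t ≤ 0 := by
  by_cases h : ∃ t, T ≤ t ∧ 0 ≤ F t
  · obtain ⟨t, ht, h0⟩ := h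
    left
    filter_upwards [eventually_ge_atTop t] with s hs
    exact h0.trans (hF ht (ht.trans hs) hs)
  · right
    push Not at h
    filter_upwards [eventually_ge_atTop T] with s hs
    exact (h s hs).le

/-- Linear polynomials in the variable over a Hardy field have a sign near infinity. -/
theorem IsHardyField.eventually_sign_linear (hH : IsHardyField H) {a b : ℝ → ℝ}
    (ha : (a : Germ (atTop : Filter ℝ) ℝ) ∈ H) (hb : (b : Germ (atTop : Filter ℝ) ℝ) ∈ H) :
    (∀ᶠ t in atTop, 0 ≤ t * a t + b t) ∨ ∀ᶠ t in atTop, t * a t + b t ≤ 0 := by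
  rcases hH.exists_inv ha with h0 | ⟨g, hg, hag⟩
  · rcases hH.eventually_sign hb with h | h | h
    · left
      filter_upwards [h0, h] with t h1 h2
      simp [h1, h2]
    · left
      filter_upwards [h0, h] with t h1 h2
      simp only [h1, Pi.zero_apply, mul_zero, zero_add]
      exact h2.le
    · right
      filter_upwards [h0, h] with t h1 h2
      simp only [h1, Pi.zero_apply, mul_zero, zero_add]
      exact h2.le
  have hr : ((b * g : ℝ → ℝ) : Germ (atTop : Filter ℝ) ℝ) ∈ H := H.mul_mem hb hg
  have hr' : ((1 + deriv (b * g) : ℝ → ℝ) : Germ (atTop : Filter ℝ) ℝ) ∈ H :=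
    H.add_mem H.one_mem (hH.deriv_mem' hr)
  -- The variable `t` need not belong to `H`. After division by `a`, however, `t + b / a` has
  -- derivative `1 + (b / a)'` in `H`, so it is eventually monotone and has an eventual sign.
  have key : (∀ᶠ t in atTop, 0 ≤ t + b t * g t) ∨ ∀ᶠ t in atTop, t + b t * g t ≤ 0 := by
    have hs : (∀ᶠ t in atTop, 0 ≤ (1 + deriv (b * g)) t) ∨
        ∀ᶠ t in atTop, (1 + deriv (b * g)) t ≤ 0 := by
      rcases hH.eventually_sign hr' with h | h | h
      · exact Or.inl (h.mono fun t ht => ht.ge)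
      · exact Or.inl (h.mono fun t ht => ht.le)
      · exact Or.inr (h.mono fun t ht => ht.le)
    have hd : ∀ᶠ t in atTop, HasDerivAt (fun t => t + b t * g t) ((1 + deriv (b * g)) t) t :=
      (hH.eventually_differentiableAt hr).mono fun t ht => (hasDerivAt_id t).add ht.hasDerivAt
    rcases hs with h | h
    · obtain ⟨T, hT⟩ := eventually_atTop.1 (hd.and h)
      exact eventually_nonneg_or_nonpos_of_monotoneOn
        (monotoneOn_Ici_of_hasDerivAt (fun t ht => (hT t ht).1) (fun t ht => (hT t ht).2))
    · obtain ⟨T, hT⟩ := eventually_atTop.1 (hd.and h)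
      have := (antitoneOn_Ici_of_hasDerivAt (fun t ht => (hT t ht).1) (fun t ht => (hT t ht).2)).neg
      rcases eventually_nonneg_or_nonpos_of_monotoneOn this with h | h
      · exact Or.inr (h.mono fun t ht => neg_nonneg.1 ht)
      · exact Or.inl (h.mono fun t ht => neg_nonpos.1 ht)
  have e : ∀ t, a t * g t = 1 → t * a t + b t = a t * (t + b t * g t) := by
    intro t ht
    linear_combination -(b t) * ht
  rcases hH.eventually_sign ha with h | h | h
  · exfalso
    obtain ⟨t, h1, h2⟩ := (h.and hag).exists
    simp [h1] at h2
  · rcases key with k | k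
    · left
      filter_upwards [h, k, hag] with t h1 h2 h3
      rw [e t h3]
      exact mul_nonneg h1.le h2
    · right
      filter_upwards [h, k, hag] with t h1 h2 h3
      rw [e t h3]
      exact mul_nonpos_of_nonneg_of_nonpos h1.le h2
  · rcases key with k | k
    · right
      filter_upwards [h, k, hag] with t h1 h2 h3
      rw [e t h3]
      exact mul_nonpos_of_nonpos_of_nonneg h1.le h2
    · left
      filter_upwards [h, k, hag] with t h1 h2 h3
      rw [e t h3]
      exact mul_nonneg_of_nonpos_of_nonpos h1.le h2

/-- This compares the logarithmic slope `t u' / u` of a positive `u` with the rational `p / q`.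
Integer coefficients are used because real constants need not lie in `H`. -/
theorem IsHardyField.eventually_compare (hH : IsHardyField H) {u : ℝ → ℝ}
    (hu : (u : Germ (atTop : Filter ℝ) ℝ) ∈ H) (p q : ℕ) :
    (∀ᶠ t in atTop, p * u t ≤ q * (t * deriv u t)) ∨
      ∀ᶠ t in atTop, q * (t * deriv u t) ≤ p * u t := by
  have h1 : (((q : ℝ → ℝ) * deriv u : ℝ → ℝ) : Germ (atTop : Filter ℝ) ℝ) ∈ H :=
    H.mul_mem (natCast_mem H q) (hH.deriv_mem' hu)
  have h2 : ((-((p : ℝ → ℝ) * u) : ℝ → ℝ) : Germ (atTop : Filter ℝ) ℝ) ∈ H :=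
    H.neg_mem (H.mul_mem (natCast_mem H p) hu)
  rcases hH.eventually_sign_linear h1 h2 with h | h
  · left
    filter_upwards [h] with t ht
    simp only [Pi.mul_apply, Pi.neg_apply, Pi.natCast_apply] at ht
    linarith
  · right
    filter_upwards [h] with t ht
    simp only [Pi.mul_apply, Pi.neg_apply, Pi.natCast_apply] at ht
    linarith

/-! ### Power bounds and growth rates -/

/-- The sign of `t u' - α u` decides the monotonicity of `u / t ^ α`, which turns slope comparisons
into power bounds. -/
theorem hasDerivAt_mul_rpow_neg {u : ℝ → ℝ} {t α : ℝ} (ht : 0 < t) (hu : DifferentiableAt ℝ u t) :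
    HasDerivAt (fun t => u t * t ^ (-α)) (t ^ (-α - 1) * (t * deriv u t - α * u t)) t := by
  have := hu.hasDerivAt.mul (Real.hasDerivAt_rpow_const (p := -α) (Or.inl ht.ne'))
  refine this.congr_deriv ?_
  have : t ^ (-α) = t ^ (-α - 1) * t := by
    rw [← Real.rpow_add_one ht.ne']
    congr 1
    ring
  rw [this]
  ring

theorem exists_eventually_le_rpow {u : ℝ → ℝ} {α : ℝ} (hd : ∀ᶠ t in atTop, DifferentiableAt ℝ u t)
    (h : ∀ᶠ t in atTop, t * deriv u t ≤ α * u t) : ∃ C : ℝ, 0 < C ∧ ∀ᶠ t in atTop, u t ≤ C * t ^ α := by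
  obtain ⟨T, hT⟩ := eventually_atTop.1 ((hd.and h).and (eventually_gt_atTop 0))
  have := antitoneOn_Ici_of_hasDerivAt
    (fun t ht => hasDerivAt_mul_rpow_neg (α := α) (hT t ht).2 (hT t ht).1.1)
    (fun t ht => mul_nonpos_of_nonneg_of_nonpos (Real.rpow_nonneg (hT t ht).2.le _)
      (by linarith [(hT t ht).1.2]))
  -- The maximum with `1` keeps the constant positive, as no sign of `u` is assumed.
  refine ⟨max 1 (u T * T ^ (-α)), by positivity, ?_⟩
  filter_upwards [eventually_ge_atTop T] with t ht
  have h0 := (hT t ht).2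
  have h1 := (this Set.self_mem_Ici ht ht).trans (le_max_right 1 _)
  simp only [Real.rpow_neg h0.le] at h1
  rwa [← div_eq_mul_inv, div_le_iff₀ (Real.rpow_pos_of_pos h0 _)] at h1

theorem exists_eventually_rpow_le {u : ℝ → ℝ} {α : ℝ} (hd : ∀ᶠ t in atTop, DifferentiableAt ℝ u t)
    (hpos : ∀ᶠ t in atTop, 0 < u t) (h : ∀ᶠ t in atTop, α * u t ≤ t * deriv u t) :
    ∃ C : ℝ, 0 < C ∧ ∀ᶠ t in atTop, C * t ^ α ≤ u t := by
  obtain ⟨T, hT⟩ := eventually_atTop.1 (((hd.and h).and hpos).and (eventually_gt_atTop 0))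
  have := monotoneOn_Ici_of_hasDerivAt
    (fun t ht => hasDerivAt_mul_rpow_neg (α := α) (hT t ht).2 (hT t ht).1.1.1)
    (fun t ht => mul_nonneg (Real.rpow_nonneg (hT t ht).2.le _) (by linarith [(hT t ht).1.1.2]))
  refine ⟨u T * T ^ (-α), mul_pos (hT T le_rfl).1.2 (Real.rpow_pos_of_pos (hT T le_rfl).2 _), ?_⟩
  filter_upwards [eventually_ge_atTop T] with t ht
  have h0 := (hT t ht).2
  have h1 := this Set.self_mem_Ici ht ht
  simp only [Real.rpow_neg h0.le] at h1
  rwa [← div_eq_mul_inv (u t), le_div_iff₀ (Real.rpow_pos_of_pos h0 _)] at h1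

theorem eventually_mul_rpow_le_rpow (C : ℝ) {α β : ℝ} (h : α < β) :
    ∀ᶠ t : ℝ in atTop, C * t ^ α ≤ t ^ β := by
  have := (tendsto_rpow_atTop (sub_pos.2 h)).eventually_ge_atTop C
  filter_upwards [this, eventually_gt_atTop 0] with t ht h0
  calc C * t ^ α ≤ t ^ (β - α) * t ^ α := mul_le_mul_of_nonneg_right ht (Real.rpow_nonneg h0.le _)
    _ = t ^ β := by rw [← Real.rpow_add h0]; congr 1; ring

theorem HasGrowthRate.eventually_le {h : ℝ → ℝ} {c α : ℝ} (hc : HasGrowthRate h c) (hα : c < α) :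
    ∀ᶠ t : ℝ in atTop, h t ≤ t ^ α := by
  obtain ⟨β, hβ, -, hβα⟩ := hc.exists_between hα
  filter_upwards [hβ, eventually_ge_atTop 1] with t ht h1
  exact (le_abs_self _).trans (ht.trans (Real.rpow_le_rpow_of_exponent_le h1 hβα.le))

theorem HasGrowthRate.le_of_eventually_le {h : ℝ → ℝ} {c α C : ℝ} (hc : HasGrowthRate h c)
    (hpos : ∀ᶠ t : ℝ in atTop, 0 < h t) (hα : ∀ᶠ t : ℝ in atTop, h t ≤ C * t ^ α) : c ≤ α := by
  apply le_of_forall_gt_imp_ge_of_dense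
  intro β hβ
  apply hc.1
  filter_upwards [hα, eventually_mul_rpow_le_rpow C hβ, hpos] with t h1 h2 h3
  rw [abs_of_pos h3]
  exact h1.trans h2

theorem HasGrowthRate.not_eventually_ge {h : ℝ → ℝ} {c α C : ℝ} (hc : HasGrowthRate h c) (hC : 0 < C)
    (hα : ∀ᶠ t : ℝ in atTop, C * t ^ α ≤ h t) : α ≤ c := by
  by_contra hlt
  push Not at hlt
  obtain ⟨β, h1, h2⟩ := exists_between hlt
  obtain ⟨t, h3, h4, h5, h6⟩ := (hα.and ((hc.eventually_le h1).and
    ((eventually_mul_rpow_le_rpow (2 / C) h2).and (eventually_gt_atTop 0)))).exists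
  have : 0 < t ^ β := Real.rpow_pos_of_pos h6 _
  have h7 : C * (2 / C * t ^ β) ≤ C * t ^ α := mul_le_mul_of_nonneg_left h5 hC.le
  rw [← mul_assoc, mul_div_cancel₀ _ hC.ne'] at h7
  linarith

/-! ### Regularity of functions in a Hardy field -/

/-- Regularity near infinity of a function of growth rate between `1` and `2` in a Hardy field. -/
structure RegularFrom (h : ℝ → ℝ) (q : ℕ) (T : ℝ) : Prop where
  one_le : 1 ≤ T
  differentiableAt : ∀ t, T ≤ t → DifferentiableAt ℝ h t
  differentiableAt_deriv : ∀ t, T ≤ t → DifferentiableAt ℝ (deriv h) t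
  pos : ∀ t, T ≤ t → 0 < h t
  one_le_deriv : ∀ t, T ≤ t → 1 ≤ deriv h t
  deriv_le : ∀ t, T ≤ t → t * deriv h t ≤ 2 * h t
  le_deriv2 : ∀ t, T ≤ t → deriv h t ≤ q * (t * deriv (deriv h) t)
  antitone : AntitoneOn (fun t => deriv (deriv h) t / deriv h t ^ 3) (Set.Ici T)

/-- Each inequality is one side of an eventual dichotomy; the other side would integrate to a power
bound contradicting the growth rate, or, for the curvature, keep `h` bounded. -/
theorem IsHardyField.exists_regularFrom (hH : IsHardyField H) {h : ℝ → ℝ}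
    (hh : (h : Germ (atTop : Filter ℝ) ℝ) ∈ H) (hpos : ∀ᶠ t : ℝ in atTop, 0 < h t)
    {c : ℝ} (hc1 : 1 < c) (hc2 : c < 2) (hc : HasGrowthRate h c) :
    ∃ q : ℕ, 0 < q ∧ ∃ T₀, ∀ T, T₀ ≤ T → RegularFrom h q T := by
  have hd := hH.eventually_differentiableAt hh
  have hh' := hH.deriv_mem' hh
  have hh'' := hH.deriv_mem' hh'
  have hd' := hH.eventually_differentiableAt hh'
  have hd'' := hH.eventually_differentiableAt hh''
  have A1 : ∀ᶠ t in atTop, h t ≤ t * deriv h t := by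
    rcases hH.eventually_compare hh 1 1 with h1 | h1
    · simpa using h1
    · exfalso
      obtain ⟨C, -, hC⟩ := exists_eventually_le_rpow (α := 1) hd (by simpa using h1)
      linarith [hc.le_of_eventually_le hpos hC]
  have A2 : ∀ᶠ t in atTop, t * deriv h t ≤ 2 * h t := by
    rcases hH.eventually_compare hh 2 1 with h1 | h1
    · exfalso
      obtain ⟨C, hC0, hC⟩ := exists_eventually_rpow_le (α := 2) hd hpos (by simpa using h1)
      linarith [hc.not_eventually_ge hC0 hC]
    · simpa using h1
  have A3 : ∀ᶠ t in atTop, 0 < deriv h t := by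
    filter_upwards [A1, hpos, eventually_gt_atTop 0] with t h1 h2 h3
    exact pos_of_mul_pos_right (h2.trans_le h1) h3.le
  -- If `t h'' ≤ h' / q` held eventually, then `h ≤ t h' ≤ C t ^ (1 + 1 / q)`, which `1 / q < c - 1`
  -- excludes.
  obtain ⟨n, hn⟩ := exists_nat_one_div_lt (sub_pos.2 hc1)
  set q : ℕ := n + 1 with hq
  have hq0 : (0 : ℝ) < q := by positivity
  have hq1 : 1 / (q : ℝ) < c - 1 := by rw [hq]; push_cast; exact hn
  have A4 : ∀ᶠ t in atTop, deriv h t ≤ q * (t * deriv (deriv h) t) := by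
    rcases hH.eventually_compare hh' 1 q with h1 | h1
    · simpa using h1
    · exfalso
      obtain ⟨C, hC0, hC⟩ := exists_eventually_le_rpow (α := 1 / q) hd' (h1.mono fun t ht => by
        rw [one_div_mul_eq_div, le_div_iff₀ hq0]
        simp only [Nat.cast_one, one_mul] at ht
        linarith)
      have : ∀ᶠ t in atTop, h t ≤ C * t ^ (1 / (q : ℝ) + 1) := by
        filter_upwards [A1, hC, eventually_gt_atTop 0] with t h1 h2 h3
        calc h t ≤ t * deriv h t := h1
          _ ≤ t * (C * t ^ (1 / (q : ℝ))) := mul_le_mul_of_nonneg_left h2 h3.le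
          _ = _ := by rw [Real.rpow_add_one h3.ne']; ring
      linarith [hc.le_of_eventually_le hpos this]
  have A5 : ∀ᶠ t in atTop, 1 ≤ deriv h t := by
    obtain ⟨C, hC0, hC⟩ := exists_eventually_rpow_le (α := 1 / q) hd' A3 (A4.mono fun t ht => by
        rw [one_div_mul_eq_div, div_le_iff₀ hq0]
        linarith)
    have : (0 : ℝ) < 1 / q := by positivity
    filter_upwards [hC, eventually_mul_rpow_le_rpow (1 / C) this] with t h1 h2
    rw [Real.rpow_zero, mul_one, div_le_iff₀ hC0] at h2
    linarith
  have A6 : ∀ᶠ t in atTop, 0 < deriv (deriv h) t := by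
    filter_upwards [A4, A3, eventually_gt_atTop 0] with t h1 h2 h3
    exact pos_of_mul_pos_right (pos_of_mul_pos_right (h2.trans_le h1) hq0.le) h3.le
  set P : ℝ → ℝ := fun t => deriv (deriv h) t / deriv h t ^ 3 with hP
  set Q : ℝ → ℝ := deriv (deriv (deriv h)) * deriv h - 3 * deriv (deriv h) ^ 2 with hQ
  have hQH : (Q : Germ (atTop : Filter ℝ) ℝ) ∈ H :=
    H.sub_mem (H.mul_mem (hH.deriv_mem' hh'') hh') (H.mul_mem (natCast_mem H 3) (H.pow_mem hh'' 2))
  have hPd : ∀ᶠ t in atTop, HasDerivAt P (Q t / deriv h t ^ 4) t := by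
    filter_upwards [hd', hd'', A3] with t h1 h2 h3
    have := h2.hasDerivAt.div (h1.hasDerivAt.pow 3) (pow_ne_zero 3 h3.ne')
    refine this.congr_deriv ?_
    have e : Q t = deriv (deriv (deriv h)) t * deriv h t - 3 * deriv (deriv h) t ^ 2 := rfl
    rw [e]
    simp only [Pi.pow_apply]
    field_simp
    push_cast
    ring
  have hsign : (∀ᶠ t in atTop, 0 ≤ Q t) ∨ ∀ᶠ t in atTop, Q t ≤ 0 := by
    rcases hH.eventually_sign hQH with h | h | h
    · exact Or.inl (h.mono fun t ht => ht.ge)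
    · exact Or.inl (h.mono fun t ht => ht.le)
    · exact Or.inr (h.mono fun t ht => ht.le)
  have A7 : ∃ T, AntitoneOn P (Set.Ici T) := by
    rcases hsign with hs | hs
    · exfalso
      obtain ⟨T, hT⟩ := eventually_atTop.1 ((((hPd.and hs).and (A3.and A5)).and (A6.and hd')).and hd)
      have hm := monotoneOn_Ici_of_hasDerivAt (fun t ht => (hT t ht).1.1.1.1)
        (fun t ht => div_nonneg (hT t ht).1.1.1.2 (by positivity [(hT t ht).1.1.2.1]))
      have hp0 : 0 < P T := div_pos (hT T le_rfl).1.2.1 (pow_pos (hT T le_rfl).1.1.2.1 3)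
      -- If `P` were nondecreasing, then `(1 / h')' = -P h' ≤ -P(T) h'`, so `1 / h' + P(T) h` would
      -- be nonincreasing. This is impossible, since `1 / h'` is positive and `h` tends to infinity.
      have ha := antitoneOn_Ici_of_hasDerivAt (T := T) (F := fun t => (deriv h t)⁻¹ + P T * h t)
        (F' := fun t => -deriv (deriv h) t / deriv h t ^ 2 + P T * deriv h t)
        (fun t ht => ((hT t ht).1.2.2.hasDerivAt.inv (hT t ht).1.1.2.1.ne').add
          ((hT t ht).2.hasDerivAt.const_mul _))
        (fun t ht => by
          have h3 := (hT t ht).1.1.2.1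
          have h1 := hm Set.self_mem_Ici ht ht
          have e : deriv (deriv h) t / deriv h t ^ 2 = P t * deriv h t := by
            simp only [hP]
            field_simp
          rw [neg_div, e]
          nlinarith)
      have hmono := monotoneOn_Ici_of_hasDerivAt (T := T) (F := fun t => h t - t)
        (F' := fun t => deriv h t - 1) (fun t ht => (hT t ht).2.hasDerivAt.sub (hasDerivAt_id t))
        (fun t ht => by linarith [(hT t ht).1.1.2.2])
      set M := ((deriv h T)⁻¹ + P T * h T) / P T with hM
      obtain ⟨t, h1, h2⟩ := ((eventually_ge_atTop T).and
        (eventually_gt_atTop (M - (h T - T)))).exists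
      have b1 := ha Set.self_mem_Ici h1 h1
      have b2 := hmono Set.self_mem_Ici h1 h1
      have b3 : 0 < (deriv h t)⁻¹ := inv_pos.2 (hT t h1).1.1.2.1
      simp only at b1 b2
      have b4 : M < h t := by linarith
      rw [hM, div_lt_iff₀ hp0] at b4
      linarith
    · obtain ⟨T, hT⟩ := eventually_atTop.1 ((hPd.and hs).and A3)
      exact ⟨T, antitoneOn_Ici_of_hasDerivAt (fun t ht => (hT t ht).1.1)
        (fun t ht => div_nonpos_of_nonpos_of_nonneg (hT t ht).1.2
          (pow_nonneg (hT t ht).2.le 4))⟩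
  obtain ⟨T₁, hT₁⟩ := A7
  obtain ⟨T, hT⟩ := eventually_atTop.1 ((((eventually_ge_atTop 1).and (eventually_ge_atTop T₁)).and
    ((hd.and hd').and hpos)).and ((A5.and A2).and A4))
  refine ⟨q, by omega, T, fun T' hT' => ⟨?_, ?_, ?_, ?_, ?_, ?_, ?_, ?_⟩⟩
  · exact (hT T' hT').1.1.1
  · exact fun t ht => (hT t (hT'.trans ht)).1.2.1.1
  · exact fun t ht => (hT t (hT'.trans ht)).1.2.1.2
  · exact fun t ht => (hT t (hT'.trans ht)).1.2.2
  · exact fun t ht => (hT t (hT'.trans ht)).2.1.1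
  · exact fun t ht => (hT t (hT'.trans ht)).2.1.2
  · exact fun t ht => (hT t (hT'.trans ht)).2.2
  · exact hT₁.mono (Set.Ici_subset_Ici.2 (hT T' hT').1.1.2)

/-! ### The inverse function and its curvature -/

/-- The curvature of the inverse of `h`: minus its second derivative, pulled back along `h`. -/
noncomputable def invCurvature (h : ℝ → ℝ) (t : ℝ) : ℝ := deriv (deriv h) t / deriv h t ^ 3

namespace RegularFrom

variable {h : ℝ → ℝ} {q : ℕ} {T : ℝ}

theorem hasDerivAt (R : RegularFrom h q T) {t : ℝ} (ht : T ≤ t) : HasDerivAt h (deriv h t) t :=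
  (R.differentiableAt t ht).hasDerivAt

theorem hasDerivAt_deriv (R : RegularFrom h q T) {t : ℝ} (ht : T ≤ t) :
    HasDerivAt (deriv h) (deriv (deriv h) t) t :=
  (R.differentiableAt_deriv t ht).hasDerivAt

theorem monotoneOn_sub_id (R : RegularFrom h q T) : MonotoneOn (fun t => h t - t) (Set.Ici T) :=
  monotoneOn_Ici_of_hasDerivAt (F' := fun t => deriv h t - 1)
    (fun t ht => (R.hasDerivAt ht).sub (hasDerivAt_id t)) (fun t ht => by linarith [R.one_le_deriv t ht])

theorem sub_le_sub (R : RegularFrom h q T) {s t : ℝ} (hs : T ≤ s) (hst : s ≤ t) :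
    t - s ≤ h t - h s := by
  have := R.monotoneOn_sub_id (Set.mem_Ici.2 hs) (Set.mem_Ici.2 (hs.trans hst)) hst
  simp only at this
  linarith

theorem le_of_apply_le (R : RegularFrom h q T) {s t : ℝ} (ht : T ≤ t) (hst : h s ≤ h t) :
    s ≤ t := by
  by_contra hcon
  push Not at hcon
  linarith [R.sub_le_sub ht hcon.le]

/-- From `h'' ≥ h' / (q t)` the curvature is at least `t / (q (t h') ^ 2)`, and `t h' ≤ 2 h` gives
the factor `4`. -/
theorem le_invCurvature (R : RegularFrom h q T) {t : ℝ} (ht : T ≤ t) :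
    t / (4 * q * h t ^ 2) ≤ invCurvature h t := by
  have h1 := R.one_le_deriv t ht
  have h2 := R.le_deriv2 t ht
  have h3 := R.deriv_le t ht
  have h0 := R.pos t ht
  have t0 : 0 < t := by linarith [R.one_le]
  have hq : 0 < (q : ℝ) := by
    rcases Nat.eq_zero_or_pos q with rfl | hq
    · simp at h2; linarith
    · exact_mod_cast hq
  have h4 : (t * deriv h t) ^ 2 ≤ (2 * h t) ^ 2 := pow_le_pow_left₀ (by positivity) h3 2
  rw [invCurvature, div_le_div_iff₀ (by positivity) (by positivity)]
  have d2 : 0 ≤ deriv (deriv h) t := by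
    by_contra hcon
    push Not at hcon
    have : (q : ℝ) * (t * deriv (deriv h) t) ≤ 0 :=
      mul_nonpos_of_nonneg_of_nonpos hq.le (mul_nonpos_of_nonneg_of_nonpos t0.le hcon.le)
    linarith
  have h5 : t * (deriv h t ^ 2 * deriv h t) ≤ t * (deriv h t ^ 2 * (q * (t * deriv (deriv h) t))) := by
    gcongr
  have h6 : (t * deriv h t) ^ 2 * (q * deriv (deriv h) t) ≤ (2 * h t) ^ 2 * (q * deriv (deriv h) t) := by
    gcongr
  nlinarith

/-- The inverse function of a regular function and its first two derivatives. -/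
theorem exists_inverse (R : RegularFrom h q T) : ∃ φ : ℝ → ℝ,
    (∀ y, h T ≤ y → T ≤ φ y ∧ h (φ y) = y) ∧
    (∀ y z, h T ≤ y → y ≤ z → φ y ≤ φ z ∧ φ z - φ y ≤ z - y) ∧
    (∀ y, h T < y → HasDerivAt φ (deriv h (φ y))⁻¹ y) ∧
    (∀ y, h T < y → HasDerivAt (fun y => (deriv h (φ y))⁻¹) (-invCurvature h (φ y)) y) := by
  have hsurj : ∀ y, h T ≤ y → ∃ t, T ≤ t ∧ h t = y := by
    intro y hy
    have hc : ContinuousOn h (Set.Icc T (T + (y - h T))) := fun t ht =>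
      (R.hasDerivAt ht.1).continuousAt.continuousWithinAt
    have hle : T ≤ T + (y - h T) := by linarith
    obtain ⟨t, ht, hty⟩ := intermediate_value_Icc hle hc
      ⟨hy, by linarith [R.sub_le_sub le_rfl hle]⟩
    exact ⟨t, ht.1, hty⟩
  choose! φ hφ using hsurj
  have hmono : ∀ y z, h T ≤ y → y ≤ z → φ y ≤ φ z ∧ φ z - φ y ≤ z - y := by
    intro y z hy hyz
    obtain ⟨a1, a2⟩ := hφ y hy
    obtain ⟨b1, b2⟩ := hφ z (hy.trans hyz)
    have hle : φ y ≤ φ z := R.le_of_apply_le b1 (by rw [a2, b2]; exact hyz)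
    refine ⟨hle, ?_⟩
    have := R.sub_le_sub a1 hle
    rwa [a2, b2] at this
  have hcont : ∀ y, h T < y → ContinuousAt φ y := by
    intro y hy
    -- Because `h' ≥ 1`, the inverse is 1-Lipschitz; this continuity is what the inverse function
    -- rule needs.
    have hL : LipschitzOnWith 1 φ (Set.Ici (h T)) := by
      apply LipschitzOnWith.of_dist_le_mul
      intro a ha b hb
      rw [NNReal.coe_one, one_mul, Real.dist_eq, Real.dist_eq]
      rcases le_total a b with hab | hab
      · obtain ⟨h1, h2⟩ := hmono a b ha hab
        rw [abs_of_nonpos (by linarith), abs_of_nonpos (by linarith)]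
        linarith
      · obtain ⟨h1, h2⟩ := hmono b a hb hab
        rw [abs_of_nonneg (by linarith), abs_of_nonneg (by linarith)]
        linarith
    exact hL.continuousOn.continuousAt (Ici_mem_nhds hy)
  have hd : ∀ y, h T < y → HasDerivAt φ (deriv h (φ y))⁻¹ y := by
    intro y hy
    have h1 := (hφ y hy.le).1
    apply HasDerivAt.of_local_left_inverse (hcont y hy) (R.hasDerivAt h1)
    · linarith [R.one_le_deriv _ h1]
    · filter_upwards [Ioi_mem_nhds hy] with z hz
      exact (hφ z (le_of_lt hz)).2
  refine ⟨φ, hφ, hmono, hd, fun y hy => ?_⟩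
  have h1 := (hφ y hy.le).1
  have h2 := R.one_le_deriv _ h1
  have h3 : deriv h (φ y) ≠ 0 := by linarith
  have h4 : HasDerivAt (fun y => deriv h (φ y)) (deriv (deriv h) (φ y) * (deriv h (φ y))⁻¹) y :=
    (R.hasDerivAt_deriv h1).comp y (hd y hy)
  refine (h4.inv h3).congr_deriv ?_
  rw [invCurvature]
  field_simp

end RegularFrom

/-! ### The smooth main term -/

/-- Increments of the inverse of a regular function: a convex sequence with decrements bounded below
by the curvature. -/
theorem increment_bounds {φ φ₁ φ₂ : ℝ → ℝ} {Y : ℝ}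
    (h1 : ∀ y, Y ≤ y → HasDerivAt φ (φ₁ y) y) (h2 : ∀ y, Y ≤ y → HasDerivAt φ₁ (-φ₂ y) y)
    (h3 : AntitoneOn φ₂ (Set.Ici Y)) {y : ℝ} (hy : Y ≤ y) :
    φ₂ (y + 2) ≤ (φ (y + 1) - φ y) - (φ (y + 2) - φ (y + 1)) ∧
    (φ (y + 2) - φ (y + 1)) - (φ (y + 3) - φ (y + 2)) ≤ (φ (y + 1) - φ y) - (φ (y + 2) - φ (y + 1)) := by
  have s1 : ∀ a y, Y ≤ y → 0 ≤ a → HasDerivAt (fun y => φ (y + a)) (φ₁ (y + a)) y := by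
    intro a y hy ha
    exact (h1 (y + a) (by linarith)).comp_add_const y a
  have s2 : ∀ a y, Y ≤ y → 0 ≤ a → HasDerivAt (fun y => φ₁ (y + a)) (-φ₂ (y + a)) y := by
    intro a y hy ha
    exact (h2 (y + a) (by linarith)).comp_add_const y a
  constructor
  · set m := φ₂ (y + 2) with hm
    -- Two mean value theorems express minus the second difference as a value of `φ₂` at a point of
    -- `[y, y + 2]`, and `φ₂` is smallest at the right end.
    have k1 : ∀ s, Y ≤ s → s + 1 ≤ y + 2 → m ≤ φ₁ s - φ₁ (s + 1) := by
      intro s hs hs2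
      have hc : ∀ u ∈ Set.Icc s (s + 1), HasDerivAt φ₁ (-φ₂ u) u := fun u hu => h2 u (hs.trans hu.1)
      obtain ⟨r, hr, hre⟩ := exists_hasDerivAt_eq_slope φ₁ (fun u => -φ₂ u) (lt_add_one s)
        (fun u hu => (hc u hu).continuousAt.continuousWithinAt)
        (fun u hu => hc u (Set.Ioo_subset_Icc_self hu))
      rw [add_sub_cancel_left, div_one] at hre
      have := h3 (hs.trans hr.1.le : Y ≤ r) (by simp; linarith : y + 2 ∈ Set.Ici Y)
        (by linarith [hr.2] : r ≤ y + 2)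
      linarith
    have hc : ∀ u ∈ Set.Icc y (y + 1), HasDerivAt (fun u => φ (u + 1) - φ u) (φ₁ (u + 1) - φ₁ u) u :=
      fun u hu => (s1 1 u (hy.trans hu.1) zero_le_one).sub (h1 u (hy.trans hu.1))
    obtain ⟨r, hr, hre⟩ := exists_hasDerivAt_eq_slope (fun u => φ (u + 1) - φ u)
      (fun u => φ₁ (u + 1) - φ₁ u) (lt_add_one y)
      (fun u hu => (hc u hu).continuousAt.continuousWithinAt)
      (fun u hu => hc u (Set.Ioo_subset_Icc_self hu))
    rw [add_sub_cancel_left, div_one] at hre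
    have := k1 r (hy.trans hr.1.le) (by linarith [hr.2])
    have e : y + 1 + 1 = y + 2 := by ring
    rw [e] at hre
    linarith
  · have m1 : MonotoneOn (fun y => φ₁ (y + 1) - φ₁ y) (Set.Ici Y) :=
      monotoneOn_Ici_of_hasDerivAt (F' := fun y => -φ₂ (y + 1) - -φ₂ y)
        (fun y hy => (s2 1 y hy zero_le_one).sub (h2 y hy)) (fun y hy => by
          have := h3 hy (by simp; linarith : y + 1 ∈ Set.Ici Y) (by linarith)
          linarith)
    -- Convexity of the increments: the derivative of the second difference is a second difference
    -- of `φ₁`, whose sign comes from the monotonicity of `φ₂`.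
    have m2 : AntitoneOn (fun y => (φ (y + 1) - φ y) - (φ (y + 2) - φ (y + 1))) (Set.Ici Y) :=
      antitoneOn_Ici_of_hasDerivAt
        (F' := fun y => (φ₁ (y + 1) - φ₁ y) - (φ₁ (y + 2) - φ₁ (y + 1)))
        (fun y hy => ((s1 1 y hy zero_le_one).sub (h1 y hy)).sub
          ((s1 2 y hy zero_le_two).sub (s1 1 y hy zero_le_one))) (fun y hy => by
          have := m1 hy (by simp; linarith : y + 1 ∈ Set.Ici Y) (by linarith)
          simp only at this
          rw [show y + 1 + 1 = y + 2 by ring] at this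
          linarith)
    have := m2 hy (by simp; linarith : y + 1 ∈ Set.Ici Y) (by linarith)
    simp only at this
    rwa [show y + 1 + 1 = y + 2 by ring, show y + 1 + 2 = y + 3 by ring] at this

/-- Fejér weights times a convex decreasing sequence: the cosine sum is bounded below. -/
theorem neg_le_sum_fejer_mul_cos_mul {D : ℕ → ℝ} {n₀ N : ℕ} (hn₀ : 1 ≤ n₀) (hN : n₀ ≤ N)
    (h0 : ∀ n, n₀ ≤ n → 0 ≤ D n) (h1 : ∀ n, n₀ ≤ n → D n ≤ 1)
    (hE : ∀ n, n₀ ≤ n → 0 ≤ D n - D (n + 1))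
    (hc : ∀ n, n₀ ≤ n → D (n + 1) - D (n + 2) ≤ D n - D (n + 1)) (y : ℝ) :
    -((n₀ + 1 : ℝ) ^ 2) ≤
      ∑ n ∈ Finset.Ico n₀ N, (1 - (n : ℝ) / N) * Real.cos (n * y) * D n := by
  have hN0 : (0 : ℝ) < N := by exact_mod_cast (by omega : 0 < N)
  set E₀ := D n₀ - D (n₀ + 1) with hE₀
  have E0 : 0 ≤ E₀ := hE n₀ le_rfl
  have E1 : E₀ ≤ 1 := by linarith [h1 n₀ le_rfl, h0 (n₀ + 1) (by omega)]
  -- Below `n₀` nothing is known about `D`, so it is continued linearly with its first slope. This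
  -- keeps it convex, decreasing and nonnegative, with values at most `n₀ + 1`.
  set d : ℕ → ℝ := fun n => if n₀ ≤ n then D n else D n₀ + ((n₀ : ℝ) - n) * E₀ with hd
  set F : ℕ → ℝ := fun n => max (1 - (n : ℝ) / N) 0 with hF
  have dge : ∀ n, n₀ ≤ n → d n = D n := fun n hn => if_pos hn
  have dle : ∀ n, n ≤ n₀ → d n = D n₀ + ((n₀ : ℝ) - n) * E₀ := by
    intro n hn
    rcases hn.eq_or_lt with rfl | hn
    · rw [dge n le_rfl]; ring
    · exact if_neg (by omega)
  have ddiff : ∀ n, n < n₀ → d n - d (n + 1) = E₀ := by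
    intro n hn
    rw [dle n hn.le, dle (n + 1) hn]
    push_cast
    ring
  have dE : ∀ n, 0 ≤ d n - d (n + 1) := by
    intro n
    rcases lt_or_ge n n₀ with hn | hn
    · rw [ddiff n hn]; exact E0
    · rw [dge n hn, dge (n + 1) (by omega)]; exact hE n hn
  have dc : ∀ n, d (n + 1) - d (n + 2) ≤ d n - d (n + 1) := by
    intro n
    rcases lt_trichotomy (n + 1) n₀ with hn | hn | hn
    · rw [ddiff n (by omega), ddiff (n + 1) hn]
    · rw [ddiff n (by omega), dge (n + 1) (by omega), dge (n + 2) (by omega), hE₀, ← hn]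
    · rw [dge n (by omega), dge (n + 1) (by omega), dge (n + 2) (by omega)]
      exact hc n (by omega)
  have d0 : ∀ n, 0 ≤ d n := by
    intro n
    rcases le_total n n₀ with hn | hn
    · rw [dle n hn]
      have : (n : ℝ) ≤ n₀ := by exact_mod_cast hn
      nlinarith [h0 n₀ le_rfl]
    · rw [dge n hn]; exact h0 n hn
  have d1 : ∀ n, d n ≤ n₀ + 1 := by
    intro n
    have : (0 : ℝ) ≤ n₀ := Nat.cast_nonneg _
    rcases le_total n n₀ with hn | hn
    · rw [dle n hn]
      have : (n : ℝ) ≤ n₀ := by exact_mod_cast hn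
      have : (0 : ℝ) ≤ n := Nat.cast_nonneg _
      nlinarith [h1 n₀ le_rfl]
    · rw [dge n hn]; linarith [h1 n hn]
  have hs : (0 : ℝ) < 1 / N := by positivity
  have e1 : ∀ n : ℕ, ((n + 1 : ℕ) : ℝ) / N = n / N + 1 / N := by intro n; push_cast; ring
  have e2 : ∀ n : ℕ, ((n + 2 : ℕ) : ℝ) / N = n / N + 2 * (1 / N) := by intro n; push_cast; ring
  have F0 : ∀ n, 0 ≤ F n := fun n => le_max_right _ _
  have F1 : ∀ n, F n ≤ 1 := fun n => max_le (by linarith [(by positivity : (0 : ℝ) ≤ n / N)]) zero_le_one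
  have FE : ∀ n, 0 ≤ F n - F (n + 1) := by
    intro n
    simp only [hF, e1]
    have : max (1 - ((n : ℝ) / N + 1 / N)) 0 ≤ max (1 - (n : ℝ) / N) 0 :=
      max_le_max (by linarith) le_rfl
    linarith
  have Fc : ∀ n, F (n + 1) - F (n + 2) ≤ F n - F (n + 1) := by
    intro n
    simp only [hF]
    rw [e2, e1]
    have a1 := le_max_left (1 - (n : ℝ) / N) 0
    have a2 := le_max_right (1 - (n : ℝ) / N) 0
    have a3 := le_max_left (1 - ((n : ℝ) / N + 2 * (1 / N))) 0
    have a4 := le_max_right (1 - ((n : ℝ) / N + 2 * (1 / N))) 0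
    rcases max_cases (1 - ((n : ℝ) / N + 1 / N)) 0 with h | h <;> linarith
  have FN : ∀ n, N ≤ n → F n = 0 := by
    intro n hn
    have : (N : ℝ) ≤ n := by exact_mod_cast hn
    have : 1 ≤ (n : ℝ) / N := by rwa [le_div_iff₀ hN0, one_mul]
    exact max_eq_right (by linarith)
  have main := neg_half_le_sum_convex_mul_cos (w := fun n => F n * d n) (N := N)
    (by simp [FN N le_rfl]) (by simp [FN (N + 1) (by omega)]) (by
      intro n _
      have p := dE (n + 1)
      have p' := dc n
      have r := FE (n + 1)
      have r' := Fc n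
      -- The second difference of `F * d` is the sum of the four products in `q1` to `q4`.
      have q1 : 0 ≤ F (n + 1) * ((d n - d (n + 1)) - (d (n + 1) - d (n + 2))) :=
        mul_nonneg (F0 _) (by linarith)
      have q2 : 0 ≤ d (n + 1) * ((F n - F (n + 1)) - (F (n + 1) - F (n + 2))) :=
        mul_nonneg (d0 _) (by linarith)
      have q3 : 0 ≤ (F n - F (n + 1)) * (d n - d (n + 1)) := mul_nonneg (FE n) (dE n)
      have q4 : 0 ≤ (F (n + 1) - F (n + 2)) * (d (n + 1) - d (n + 2)) := mul_nonneg r p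
      nlinarith) y
  have e3 : ∑ n ∈ Finset.range N, F (n + 1) * d (n + 1) * Real.cos ((n + 1 : ℕ) * y) =
      ∑ n ∈ Finset.Ico 1 n₀, F n * d n * Real.cos (n * y) +
      ∑ n ∈ Finset.Ico n₀ N, (1 - (n : ℝ) / N) * Real.cos (n * y) * D n := by
    have e4 : ∑ n ∈ Finset.range N, F (n + 1) * d (n + 1) * Real.cos ((n + 1 : ℕ) * y) =
        ∑ n ∈ Finset.Ico 1 (N + 1), F n * d n * Real.cos (n * y) := by
      rw [Finset.sum_Ico_eq_sum_range]
      simp [add_comm]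
    rw [e4, Finset.sum_Ico_succ_top (by omega), FN N le_rfl, zero_mul, zero_mul, add_zero,
      ← Finset.sum_Ico_consecutive _ hn₀ hN]
    congr 1
    apply Finset.sum_congr rfl
    intro n hn
    obtain ⟨k1, k2⟩ := Finset.mem_Ico.1 hn
    have : F n = 1 - (n : ℝ) / N := by
      apply max_eq_left
      have : (n : ℝ) / N ≤ 1 := div_le_one_of_le₀ (by exact_mod_cast k2.le) hN0.le
      linarith
    rw [dge n k1, this]
    ring
  have b1 : ∑ n ∈ Finset.Ico 1 n₀, F n * d n * Real.cos (n * y) ≤ (n₀ - 1) * (n₀ + 1) := by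
    calc _ ≤ ∑ n ∈ Finset.Ico 1 n₀, ((n₀ : ℝ) + 1) := by
          apply Finset.sum_le_sum
          intro n _
          have := Real.cos_le_one (n * y)
          have : F n * d n ≤ 1 * (n₀ + 1) := mul_le_mul (F1 n) (d1 n) (d0 n) zero_le_one
          have : 0 ≤ F n * d n := mul_nonneg (F0 n) (d0 n)
          nlinarith
      _ = _ := by
          rw [Finset.sum_const, Nat.card_Ico, nsmul_eq_mul, Nat.cast_sub hn₀]
          simp
  have b2 : F 0 * d 0 ≤ 1 * (n₀ + 1) := mul_le_mul (F1 0) (d1 0) (d0 0) zero_le_one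
  rw [e3] at main
  have : (0 : ℝ) ≤ n₀ := Nat.cast_nonneg _
  nlinarith

/-! ### The indicator of the floor set -/

/-- For `m ≥ T`, `⌊h m⌋ = n` means `φ n ≤ m < φ (n + 1)`. The number of such integers is a
difference of ceilings, at most `1` because the interval has length at most `1`, and `⌈x⌉ = x +
fract (-x)`. The hypothesis `hsmall` rules out values taken before `T`. -/
theorem RegularFrom.indicator_floorSet_eq {h : ℝ → ℝ} {q : ℕ} {T : ℝ} (R : RegularFrom h q T)
    {φ : ℝ → ℝ} (hφ : ∀ y, h T ≤ y → T ≤ φ y ∧ h (φ y) = y)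
    (hm : ∀ y z, h T ≤ y → y ≤ z → φ y ≤ φ z ∧ φ z - φ y ≤ z - y) {n : ℕ} (hn : h T ≤ n)
    (hsmall : ∀ m : ℕ, (m : ℝ) < T → ⌊h m⌋ ≠ n) :
    (floorSet h).indicator (fun _ => (1 : ℝ)) (n : ℤ) =
      (φ (n + 1) - φ n) + (Int.fract (-φ (n + 1)) - 1 / 2) - (Int.fract (-φ n) - 1 / 2) := by
  have hn1 : h T ≤ (n : ℝ) + 1 := by linarith
  obtain ⟨a1, a2⟩ := hφ n hn
  obtain ⟨b1, b2⟩ := hφ (n + 1) hn1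
  obtain ⟨c1, c2⟩ := hm n (n + 1) hn (by linarith)
  have hfr : ∀ x : ℝ, Int.fract (-x) = ⌈x⌉ - x := by
    intro x
    rw [Int.fract, Int.floor_neg]
    push_cast
    ring
  have hgoal : (φ (n + 1) - φ n) + (Int.fract (-φ (n + 1)) - 1 / 2) - (Int.fract (-φ n) - 1 / 2) =
      ((⌈φ (n + 1)⌉ - ⌈φ n⌉ : ℤ) : ℝ) := by
    rw [hfr, hfr]
    push_cast
    ring
  rw [hgoal]
  have hiff : (n : ℤ) ∈ floorSet h ↔ ∃ m : ℤ, φ n ≤ m ∧ (m : ℝ) < φ (n + 1) := by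
    constructor
    · rintro ⟨m, -, hm⟩
      have hmT : T ≤ m := by
        by_contra hcon
        exact hsmall m (not_le.1 hcon) hm.symm
      have := (Int.floor_eq_iff.1 hm.symm)
      push_cast at this
      refine ⟨m, ?_, ?_⟩
      · exact R.le_of_apply_le hmT (by rw [a2]; exact this.1)
      · by_contra hcon
        push Not at hcon
        have h1 := R.sub_le_sub b1 hcon
        push_cast at h1 hcon
        linarith [this.2]
    · rintro ⟨m, hm1, hm2⟩
      have hmT : T ≤ m := a1.trans hm1
      have hm0 : 1 ≤ m := by
        have : (1 : ℝ) ≤ m := R.one_le.trans hmT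
        exact_mod_cast this
      lift m to ℕ using by omega
      refine ⟨m, by exact_mod_cast hm0, ?_⟩
      rw [eq_comm, Int.floor_eq_iff]
      have h1 := R.sub_le_sub a1 hm1
      have h2 := R.sub_le_sub hmT hm2.le
      push_cast at h1 h2 hm1 hm2 ⊢
      constructor <;> linarith
  by_cases hmem : (n : ℤ) ∈ floorSet h
  · obtain ⟨m, hm1, hm2⟩ := hiff.1 hmem
    have h1 : ⌈φ n⌉ ≤ m := Int.ceil_le.2 hm1
    have h2 : m < ⌈φ (n + 1)⌉ := Int.lt_ceil.2 hm2
    have h3 : ⌈φ (n + 1)⌉ ≤ ⌈φ n⌉ + 1 := by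
      rw [← Int.ceil_add_one]
      exact Int.ceil_le_ceil (by linarith)
    have h4 : ⌈φ (n + 1)⌉ - ⌈φ n⌉ = 1 := by omega
    rw [h4, Set.indicator_of_mem hmem]
    norm_num
  · have h1 : ⌈φ n⌉ ≤ ⌈φ (n + 1)⌉ := Int.ceil_le_ceil c1
    have h2 : ⌈φ (n + 1)⌉ ≤ ⌈φ n⌉ := by
      rw [Int.ceil_le]
      by_contra hcon
      exact hmem (hiff.2 ⟨⌈φ n⌉, Int.le_ceil _, not_le.1 hcon⟩)
    have h4 : ⌈φ (n + 1)⌉ - ⌈φ n⌉ = 0 := by omega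
    rw [h4, Set.indicator_of_notMem hmem]
    norm_num

theorem fejerInt_natCast (N n : ℕ) : fejerInt N (n : ℤ) = max (1 - (n : ℝ) / N) 0 := by
  simp [fejerInt]

theorem fejerInt_nonneg (N : ℕ) (n : ℤ) : 0 ≤ fejerInt N n := le_max_right _ _

theorem fejerInt_le_one (N : ℕ) (n : ℤ) : fejerInt N n ≤ 1 :=
  max_le (by linarith [(by positivity : (0 : ℝ) ≤ |(n : ℝ)| / N)]) zero_le_one

theorem fejerFloor_nonneg (h : ℝ → ℝ) (N : ℕ) (n : ℤ) : 0 ≤ fejerFloor h N n :=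
  mul_nonneg (fejerInt_nonneg N n) (Set.indicator_nonneg (fun _ _ => zero_le_one) n)

theorem fejerFloor_le_one (h : ℝ → ℝ) (N : ℕ) (n : ℤ) : fejerFloor h N n ≤ 1 :=
  mul_le_one₀ (fejerInt_le_one N n) (Set.indicator_nonneg (fun _ _ => zero_le_one) n)
    (Set.indicator_le_self' (fun _ _ => zero_le_one) n)

/-- Each term is at least `-1`, so the initial segment costs at most `n₀`; the term `n = N` has
weight zero. -/
theorem sum_fejerFloor_mul_cos_ge (h : ℝ → ℝ) {n₀ N : ℕ} (hn₀ : 1 ≤ n₀) (y : ℝ) {B : ℝ} (hB0 : 0 ≤ B)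
    (hB : n₀ ≤ N → -B ≤ ∑ n ∈ Finset.Ico n₀ N, (1 - (n : ℝ) / N) * Real.cos (n * y) *
      (floorSet h).indicator (fun _ => (1 : ℝ)) (n : ℤ)) :
    -(n₀ + B) ≤ ∑ n ∈ Finset.Icc 1 N, fejerFloor h N (n : ℤ) * Real.cos (n * y) := by
  have hge : ∀ n : ℕ, -1 ≤ fejerFloor h N (n : ℤ) * Real.cos (n * y) := by
    intro n
    have := Real.neg_one_le_cos (n * y)
    nlinarith [fejerFloor_nonneg h N n, fejerFloor_le_one h N n]
  have hsum : ∀ s : Finset ℕ, -(s.card : ℝ) ≤ ∑ n ∈ s, fejerFloor h N (n : ℤ) * Real.cos (n * y) := by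
    intro s
    calc -(s.card : ℝ) = ∑ n ∈ s, (-1 : ℝ) := by simp
      _ ≤ _ := Finset.sum_le_sum fun n _ => hge n
  rcases lt_or_ge N n₀ with hN | hN
  · have h1 := hsum (Finset.Icc 1 N)
    rw [Nat.card_Icc, Nat.add_sub_cancel] at h1
    have : (N : ℝ) ≤ n₀ := by exact_mod_cast hN.le
    linarith
  · have hN0 : (0 : ℝ) < N := by exact_mod_cast (by omega : 0 < N)
    have e : Finset.Icc 1 N = Finset.Ico 1 (N + 1) := rfl
    rw [e, Finset.sum_Ico_succ_top (by omega), ← Finset.sum_Ico_consecutive _ hn₀ hN]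
    have h1 := hsum (Finset.Ico 1 n₀)
    rw [Nat.card_Ico, Nat.cast_sub hn₀] at h1
    have h2 : fejerFloor h N (N : ℤ) = 0 := by
      rw [fejerFloor, fejerInt_natCast, div_self hN0.ne']
      simp
    have h3 : ∑ n ∈ Finset.Ico n₀ N, fejerFloor h N (n : ℤ) * Real.cos (n * y) =
        ∑ n ∈ Finset.Ico n₀ N, (1 - (n : ℝ) / N) * Real.cos (n * y) *
          (floorSet h).indicator (fun _ => (1 : ℝ)) (n : ℤ) := by
      apply Finset.sum_congr rfl
      intro n hn
      have k2 := (Finset.mem_Ico.1 hn).2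
      have : (n : ℝ) / N ≤ 1 := div_le_one_of_le₀ (by exact_mod_cast k2.le) hN0.le
      rw [fejerFloor, fejerInt_natCast, max_eq_left (by linarith)]
      ring
    rw [h2, h3]
    have := hB hN
    push_cast at h1
    linarith

/-! ### Lower bound for the twisted averages -/

/-- Since `t ≥ h ^ (1 / α)`, the curvature is at least a multiple of `h ^ (1 / α - 2)`. The exponent
is negative and at least `-2`, so `h ≤ 3 * N` costs a factor `9`, and `36 = 4 * 9`. -/
theorem RegularFrom.le_invCurvature_of_le_rpow {h : ℝ → ℝ} {q : ℕ} {T : ℝ} (R : RegularFrom h q T)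
    (hq : 0 < q) {α : ℝ} (hα : 1 ≤ α) {t N : ℝ} (ht : T ≤ t) (hle : h t ≤ t ^ α)
    (hN : 1 ≤ N) (htN : h t ≤ 3 * N) :
    1 / (36 * (q : ℝ)) * N ^ (1 / α - 2) ≤ invCurvature h t := by
  have h0 := R.pos t ht
  have t0 : 0 < t := by linarith [R.one_le]
  have hq' : (0 : ℝ) < q := by exact_mod_cast hq
  refine le_trans ?_ (R.le_invCurvature ht)
  have h1 : (h t) ^ (1 / α) ≤ t := by
    have := Real.rpow_le_rpow h0.le hle (by positivity : 0 ≤ 1 / α)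
    rwa [← Real.rpow_mul t0.le, mul_one_div_cancel (by linarith), Real.rpow_one] at this
  have hα1 : 1 / α ≤ 1 := by rw [div_le_one (by linarith)]; exact hα
  have hα0 : 0 < 1 / α := by positivity
  have h2 : (3 * N) ^ (1 / α - 2) ≤ (h t) ^ (1 / α - 2) :=
    Real.rpow_le_rpow_of_nonpos h0 htN (by linarith)
  have h3 : (1 / 9 : ℝ) ≤ 3 ^ (1 / α - 2) := by
    calc (1 / 9 : ℝ) = 3 ^ (-2 : ℝ) := by norm_num [Real.rpow_neg]
      _ ≤ _ := Real.rpow_le_rpow_of_exponent_le (by norm_num) (by linarith)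
  rw [Real.mul_rpow (by norm_num) (by linarith)] at h2
  have h4 : (h t) ^ (1 / α - 2) ≤ t / h t ^ 2 := by
    rw [Real.rpow_sub h0, Real.rpow_two]
    gcongr
  have hN0 : 0 ≤ N ^ (1 / α - 2) := Real.rpow_nonneg (by linarith) _
  have h5 : 1 / 9 * N ^ (1 / α - 2) ≤ t / h t ^ 2 := by nlinarith
  calc 1 / (36 * (q : ℝ)) * N ^ (1 / α - 2) = 1 / (4 * q) * (1 / 9 * N ^ (1 / α - 2)) := by
        field_simp; norm_num
    _ ≤ 1 / (4 * q) * (t / h t ^ 2) := by gcongr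
    _ = _ := by field_simp

theorem exists_natCeil_rpow_bounds {N : ℕ} (hN : 1 ≤ N) {β : ℝ} (hβ : 0 ≤ β) :
    ∃ K : ℕ, 1 ≤ K ∧ (N : ℝ) ^ β ≤ K ∧ (K : ℝ) ≤ 2 * (N : ℝ) ^ β := by
  have hN' : (1 : ℝ) ≤ N := by exact_mod_cast hN
  have h1 : 1 ≤ (N : ℝ) ^ β := Real.one_le_rpow hN' hβ
  refine ⟨⌈(N : ℝ) ^ β⌉₊, Nat.ceil_pos.2 (by linarith), Nat.le_ceil _, ?_⟩
  linarith [Nat.ceil_lt_add_one (by linarith : 0 ≤ (N : ℝ) ^ β)]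

/-- The twisted Fejér sums over `{⌊h n⌋}` are bounded below with a power saving. -/
theorem exists_avg_fejerFloor_mul_cos_ge {H : Subring (Germ (atTop : Filter ℝ) ℝ)}
    (hH : IsHardyField H) {h : ℝ → ℝ} (hh : (h : Germ (atTop : Filter ℝ) ℝ) ∈ H)
    (hpos : ∀ᶠ t : ℝ in atTop, 0 < h t) {c : ℝ} (hc1 : 1 < c) (hc2 : c < 2) (hc : HasGrowthRate h c) :
    ∃ C : ℝ, 0 < C ∧ ∀ N : ℕ, 1 ≤ N → ∀ ξ : ℝ,
      -(C * (N : ℝ) ^ (-(1 / (5 * c)))) ≤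
        avg N (fun n => fejerFloor h N n * Real.cos (2 * Real.pi * ξ * (n : ℝ))) := by
  obtain ⟨q, hq, T₀, hT₀⟩ := hH.exists_regularFrom hh hpos hc1 hc2 hc
  -- Under `h t ≤ t ^ α` the balanced saving is `1 / (4 α)`, which is `1 / (5 c)` for this `α`. As
  -- `α > c` strictly, no `ε` is lost.
  set α : ℝ := 5 * c / 4 with hα
  have hα1 : 1 ≤ α := by rw [hα]; linarith
  obtain ⟨T₁, hT₁⟩ := eventually_atTop.1 (hc.eventually_le (by rw [hα]; linarith : c < α))
  set T := max T₀ T₁ with hT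
  have R := hT₀ T (le_max_left _ _)
  have hle : ∀ t, T ≤ t → h t ≤ t ^ α := fun t ht => hT₁ t ((le_max_right _ _).trans ht)
  obtain ⟨φ, hφ, hm, hd1, hd2⟩ := R.exists_inverse
  obtain ⟨b, hb⟩ := (((Finset.range ⌈T⌉₊).image fun m : ℕ => ⌊h m⌋).bddAbove)
  -- Beyond `n₀`, `φ` is defined and no `⌊h m⌋` with `m < T` occurs.
  obtain ⟨n₀, hn₀⟩ := exists_nat_gt (max (max 1 (h T)) b)
  have hn1 : 1 ≤ n₀ := by
    have : (1 : ℝ) < n₀ := lt_of_le_of_lt ((le_max_left _ _).trans (le_max_left _ _)) hn₀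
    exact_mod_cast this.le
  have hnT : h T < n₀ := lt_of_le_of_lt ((le_max_right _ _).trans (le_max_left _ _)) hn₀
  have hnb : b < n₀ := by
    have : (b : ℝ) < n₀ := lt_of_le_of_lt (le_max_right _ _) hn₀
    exact_mod_cast this
  have hsmall : ∀ n : ℕ, n₀ ≤ n → ∀ m : ℕ, (m : ℝ) < T → ⌊h m⌋ ≠ n := by
    intro n hn m hmT heq
    have : ⌊h m⌋ ≤ b := hb (by
      simp only [Finset.coe_image, Set.mem_image, Finset.mem_coe, Finset.mem_range]
      exact ⟨m, Nat.lt_ceil.2 hmT, rfl⟩)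
    omega
  have hge : ∀ n : ℕ, n₀ ≤ n → (n₀ : ℝ) ≤ n := fun n hn => by exact_mod_cast hn
  have hanti : AntitoneOn (fun y => invCurvature h (φ y)) (Set.Ici (n₀ : ℝ)) := by
    intro a ha b hb hab
    have ha' : h T ≤ a := hnT.le.trans ha
    exact R.antitone (hφ a ha').1 (hφ b (ha'.trans hab)).1 (hm a b ha' hab).1
  have hinc := fun (n : ℕ) (hn : n₀ ≤ n) => increment_bounds (φ := φ)
    (φ₂ := fun y => invCurvature h (φ y)) (Y := n₀)
    (fun y hy => hd1 y (hnT.trans_le hy)) (fun y hy => hd2 y (hnT.trans_le hy)) hanti (hge n hn)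
  have hD : ∀ n : ℕ, n₀ ≤ n → 0 ≤ φ (n + 1) - φ n ∧ φ (n + 1) - φ n ≤ 1 := by
    intro n hn
    have := hm n (n + 1) (hnT.le.trans (hge n hn)) (by linarith)
    constructor <;> linarith [this.1, this.2]
  set κ : ℝ := 1 / (36 * (q : ℝ)) with hκ
  have hq1 : (1 : ℝ) ≤ q := by exact_mod_cast hq
  have hκ0 : 0 < κ := by positivity
  have hκ1 : κ ≤ 1 := by rw [hκ, div_le_one (by positivity)]; linarith
  -- The range up to `3 * N` leaves room for the shifted arguments, which stay below `N + 2`.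
  have hcurv : ∀ N : ℕ, 1 ≤ N → ∀ y : ℝ, n₀ ≤ y → y ≤ 3 * N →
      κ * (N : ℝ) ^ (1 / α - 2) ≤ invCurvature h (φ y) := by
    intro N hN y hy hyN
    obtain ⟨a1, a2⟩ := hφ y (hnT.le.trans hy)
    exact R.le_invCurvature_of_le_rpow hq hα1 a1 (hle _ a1) (by exact_mod_cast hN) (by rwa [a2])
  have hαinv : 1 / α = 4 / (5 * c) := by rw [hα]; field_simp
  set Z := 5 + 8 * ∑' k : ℕ, 1 / (k : ℝ) ^ (3 / 2 : ℝ) with hZ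
  have hZ0 : 0 < Z := by
    have : 0 ≤ ∑' k : ℕ, 1 / (k : ℝ) ^ (3 / 2 : ℝ) := tsum_nonneg fun k => by positivity
    positivity
  refine ⟨n₀ + ((n₀ + 1 : ℝ) ^ 2 + 2 * (Z * (1 + 20 / Real.sqrt κ))), by positivity, ?_⟩
  intro N hN ξ
  have hN1 : (1 : ℝ) ≤ N := by exact_mod_cast hN
  have hN0 : (0 : ℝ) < N := by linarith
  set M : ℝ := (N : ℝ) ^ (1 - 1 / (5 * c)) with hM
  have h5c : 1 / (5 * c) ≤ 1 := by rw [div_le_one (by linarith)]; linarith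
  have hM1 : 1 ≤ M := Real.one_le_rpow hN1 (by linarith)
  -- As `1 / √lam` is of order `N ^ (1 - 2 / (5 c))`, this `K` makes both `N / K` and `K / √lam` of
  -- order `M`.
  obtain ⟨K, hK1, hK2, hK3⟩ := exists_natCeil_rpow_bounds hN (β := 1 / (5 * c)) (by positivity)
  set lam := κ * (N : ℝ) ^ (1 / α - 2) with hlam
  have hlam0 : 0 < lam := mul_pos hκ0 (Real.rpow_pos_of_pos hN0 _)
  have hlam1 : lam ≤ 1 := by
    apply mul_le_one₀ hκ1 (Real.rpow_nonneg hN0.le _)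
    apply Real.rpow_le_one_of_one_le_of_nonpos hN1
    have : 1 / α ≤ 1 := by rw [div_le_one (by linarith)]; exact hα1
    linarith
  have herr : (N : ℝ) / K + 10 / Real.sqrt lam * K ≤ (1 + 20 / Real.sqrt κ) * M := by
    have e1 : (N : ℝ) / (N : ℝ) ^ (1 / (5 * c)) = M := by
      rw [hM, Real.rpow_sub hN0, Real.rpow_one]
    have i1 : (N : ℝ) / K ≤ M := by
      rw [← e1]
      exact div_le_div_of_nonneg_left hN0.le (Real.rpow_pos_of_pos hN0 _) hK2
    have e2 : Real.sqrt lam = Real.sqrt κ * (N : ℝ) ^ ((1 / α - 2) / 2) := by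
      rw [hlam, Real.sqrt_mul hκ0.le, Real.sqrt_eq_rpow ((N : ℝ) ^ _), ← Real.rpow_mul hN0.le]
      congr 2
      ring
    have e3 : 10 / Real.sqrt lam * (2 * (N : ℝ) ^ (1 / (5 * c))) = 20 / Real.sqrt κ * M := by
      have : M = (N : ℝ) ^ (1 / (5 * c)) / (N : ℝ) ^ ((1 / α - 2) / 2) := by
        rw [← Real.rpow_sub hN0, hM, hαinv]
        congr 1
        field_simp
        ring
      rw [e2, this]
      have : 0 < Real.sqrt κ := Real.sqrt_pos.2 hκ0
      have : 0 < (N : ℝ) ^ ((1 / α - 2) / 2) := Real.rpow_pos_of_pos hN0 _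
      field_simp
      ring
    have i2 : 10 / Real.sqrt lam * K ≤ 20 / Real.sqrt κ * M := by
      rw [← e3]
      exact mul_le_mul_of_nonneg_left hK3 (by positivity)
    linarith
  have hkey : -((n₀ + 1 : ℝ) ^ 2 + 2 * (Z * ((1 + 20 / Real.sqrt κ) * M))) ≤ 0 ∧ (n₀ ≤ N →
      -((n₀ + 1 : ℝ) ^ 2 + 2 * (Z * ((1 + 20 / Real.sqrt κ) * M))) ≤
        ∑ n ∈ Finset.Ico n₀ N, (1 - (n : ℝ) / N) * Real.cos (n * (2 * Real.pi * ξ)) *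
          (floorSet h).indicator (fun _ => (1 : ℝ)) (n : ℤ)) := by
    refine ⟨by rw [neg_nonpos]; positivity, fun hnN => ?_⟩
    have m1 := neg_le_sum_fejer_mul_cos_mul (D := fun n : ℕ => φ (n + 1) - φ n) hn1 hnN
      (fun n hn => (hD n hn).1) (fun n hn => (hD n hn).2) (fun n hn => by
        have := (hinc n hn).1
        have h0 := hcurv (n + 2) (by omega) ((n : ℝ) + 2) (by linarith [hge n hn]) (by
          push_cast; linarith [(Nat.cast_nonneg n : (0 : ℝ) ≤ n)])
        have h1 : 0 ≤ κ * ((n + 2 : ℕ) : ℝ) ^ (1 / α - 2) :=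
          mul_nonneg hκ0.le (Real.rpow_nonneg (Nat.cast_nonneg _) _)
        have e : (n : ℝ) + 1 + 1 = n + 2 := by ring
        push_cast
        rw [e]
        linarith) (fun n hn => by
        have := (hinc n hn).2
        have e : (n : ℝ) + 1 + 1 = n + 2 := by ring
        have e' : (n : ℝ) + 2 + 1 = n + 3 := by ring
        push_cast
        rw [e, e']
        exact this) (2 * Real.pi * ξ)
    have m2 := abs_sum_fejer_sawtooth_le (x := fun n : ℕ => φ n) (ξ := ξ) hnN hN hK1 hlam0 hlam1
      (fun n hn hnN => by
        have := (hinc n hn).1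
        have hc : (n : ℝ) + 1 < N := by exact_mod_cast hnN
        have h0 := hcurv N hN ((n : ℝ) + 2) (by linarith [hge n hn]) (by linarith)
        push_cast
        linarith) (fun n hn _ => by push_cast; exact (hD n hn).1)
      (fun n hn _ => by push_cast; exact (hD n hn).2)
    have m3 := abs_sum_fejer_sawtooth_le (x := fun n : ℕ => φ (n + 1)) (ξ := ξ) hnN hN hK1 hlam0 hlam1
      (fun n hn hnN => by
        have := (hinc (n + 1) (by omega)).1
        have hc : (n : ℝ) + 1 < N := by exact_mod_cast hnN
        have h0 := hcurv N hN ((n : ℝ) + 1 + 2) (by linarith [hge n hn]) (by linarith)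
        have e : (n : ℝ) + 1 + 1 = n + 2 := by ring
        push_cast at this ⊢
        rw [add_right_comm (n : ℝ) 2 1]
        linarith) (fun n hn _ => by have := (hD (n + 1) (by omega)).1; push_cast at this ⊢; exact this)
      (fun n hn _ => by have := (hD (n + 1) (by omega)).2; push_cast at this ⊢; exact this)
    have e : ∑ n ∈ Finset.Ico n₀ N, (1 - (n : ℝ) / N) * Real.cos (n * (2 * Real.pi * ξ)) *
          (floorSet h).indicator (fun _ => (1 : ℝ)) (n : ℤ) =
        ∑ n ∈ Finset.Ico n₀ N, (1 - (n : ℝ) / N) * Real.cos (n * (2 * Real.pi * ξ)) *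
          (φ (n + 1) - φ n) +
        ∑ n ∈ Finset.Ico n₀ N, (1 - (n : ℝ) / N) * Real.cos (2 * Real.pi * (ξ * n)) *
          (Int.fract (-φ (n + 1)) - 1 / 2) -
        ∑ n ∈ Finset.Ico n₀ N, (1 - (n : ℝ) / N) * Real.cos (2 * Real.pi * (ξ * n)) *
          (Int.fract (-φ n) - 1 / 2) := by
      rw [← Finset.sum_add_distrib, ← Finset.sum_sub_distrib]
      apply Finset.sum_congr rfl
      intro n hn
      have hn := (Finset.mem_Ico.1 hn).1
      rw [R.indicator_floorSet_eq hφ hm (hnT.le.trans (hge n hn)) (hsmall n hn),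
        show 2 * Real.pi * (ξ * n) = n * (2 * Real.pi * ξ) by ring]
      ring
    rw [e]
    have m4 := mul_le_mul_of_nonneg_left herr hZ0.le
    have m2' := (abs_le.1 m2).2
    have m3' := (abs_le.1 m3).1
    linarith
  have hfin := sum_fejerFloor_mul_cos_ge h hn1 (2 * Real.pi * ξ) (by linarith [hkey.1]) hkey.2
  have e : avg N (fun n => fejerFloor h N n * Real.cos (2 * Real.pi * ξ * (n : ℝ))) =
      1 / (N : ℝ) * ∑ n ∈ Finset.Icc 1 N, fejerFloor h N (n : ℤ) * Real.cos (n * (2 * Real.pi * ξ)) := by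
    rw [avg]
    congr 1
    apply Finset.sum_congr rfl
    intro n _
    rw [mul_comm (n : ℝ)]
    push_cast
    rfl
  have e2 : (N : ℝ) ^ (-(1 / (5 * c))) = 1 / N * M := by
    rw [hM, sub_eq_add_neg, Real.rpow_add hN0, Real.rpow_one]
    field_simp
  rw [e, e2, ← mul_assoc, mul_comm _ (1 / (N : ℝ)), mul_assoc, ← mul_neg]
  apply mul_le_mul_of_nonneg_left _ (by positivity)
  refine le_trans (neg_le_neg ?_) hfin
  have p1 : (n₀ : ℝ) ≤ n₀ * M := le_mul_of_one_le_right (Nat.cast_nonneg _) hM1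
  have p2 : (n₀ + 1 : ℝ) ^ 2 ≤ (n₀ + 1 : ℝ) ^ 2 * M := le_mul_of_one_le_right (by positivity) hM1
  nlinarith

/-! ### Lower bound for the untwisted averages -/

/-- The Fejér averages over `{⌊h n⌋}` are bounded below by the expected density. -/
theorem exists_avg_fejerFloor_ge {H : Subring (Germ (atTop : Filter ℝ) ℝ)}
    (hH : IsHardyField H) {h : ℝ → ℝ} (hh : (h : Germ (atTop : Filter ℝ) ℝ) ∈ H)
    (hpos : ∀ᶠ t : ℝ in atTop, 0 < h t) {c : ℝ} (hc1 : 1 < c) (hc2 : c < 2) (hc : HasGrowthRate h c) :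
    ∃ N₀ : ℕ, ∀ ε : ℝ, 0 < ε → ∃ C : ℝ, 0 < C ∧ ∀ N : ℕ, N₀ ≤ N →
      C * (N : ℝ) ^ (-(1 - 1 / c + ε)) ≤ avg N (fejerFloor h N) := by
  obtain ⟨q, hq, T, hT⟩ := hH.exists_regularFrom hh hpos hc1 hc2 hc
  have R := hT T le_rfl
  obtain ⟨m₀, hm₀⟩ := exists_nat_ge (T + 1)
  have hT1 := R.one_le
  have hfloor : ∀ m : ℕ, m₀ ≤ m → 1 ≤ ⌊h m⌋ := by
    intro m hm
    have : (m₀ : ℝ) ≤ m := by exact_mod_cast hm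
    rw [Int.le_floor]
    have h1 := R.sub_le_sub le_rfl (by linarith : T ≤ m)
    have h2 := R.pos T le_rfl
    push_cast
    linarith
  have hmem : ∀ m : ℕ, m₀ ≤ m → ⌊h m⌋ ∈ floorSet h := by
    intro m hm
    have : (m₀ : ℝ) ≤ m := by exact_mod_cast hm
    exact ⟨m, by exact_mod_cast (by linarith : (1 : ℝ) ≤ m), rfl⟩
  set f : ℕ → ℕ := fun m => ⌊h m⌋.toNat with hf
  have hfc : ∀ m : ℕ, m₀ ≤ m → ((f m : ℕ) : ℤ) = ⌊h m⌋ := fun m hm =>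
    Int.toNat_of_nonneg (by linarith [hfloor m hm])
  have hflt : ∀ m n : ℕ, m₀ ≤ m → m < n → f m < f n := by
    intro m n hm hmn
    have hmT : T ≤ m := by
      have : (m₀ : ℝ) ≤ m := by exact_mod_cast hm
      linarith
    have hmn' : (m : ℝ) + 1 ≤ n := by exact_mod_cast hmn
    have h1 := R.sub_le_sub hmT (by linarith : (m : ℝ) ≤ n)
    have h2 : ⌊h m⌋ + 1 ≤ ⌊h n⌋ := by
      rw [← Int.floor_add_one]
      exact Int.floor_le_floor (by linarith)
    have := hfc m hm
    have := hfc n (hm.trans hmn.le)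
    omega
  have havg : ∀ N : ℕ, ∀ s : Finset ℕ, s ⊆ Finset.Icc 1 N →
      1 / (N : ℝ) * ∑ n ∈ s, fejerFloor h N (n : ℤ) ≤ avg N (fejerFloor h N) := by
    intro N s hs
    rw [avg]
    apply mul_le_mul_of_nonneg_left _ (by positivity)
    exact Finset.sum_le_sum_of_subset_of_nonneg hs fun n _ _ => fejerFloor_nonneg h N n
  have hval : ∀ N m : ℕ, m₀ ≤ m → 1 - (f m : ℝ) / N ≤ fejerFloor h N (f m : ℤ) := by
    intro N m hm
    rw [fejerFloor, fejerInt_natCast, Set.indicator_of_mem (by rw [hfc m hm]; exact hmem m hm), mul_one]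
    exact le_max_left _ _
  -- For `N > f m₀` the element `f m₀` already has positive Fejér weight; this threshold does not
  -- involve `ε`.
  refine ⟨f m₀ + 1, fun ε hε => ?_⟩
  set α := c + ε with hα
  have hα0 : 0 < α := by linarith
  have hexp : 1 / c - ε ≤ 1 / α := by
    have : 1 / c - 1 / α = ε / (c * α) := by rw [hα]; field_simp; ring
    have h2 : ε / (c * α) ≤ ε := div_le_self hε.le (by nlinarith)
    linarith
  obtain ⟨T₁, hT₁⟩ := eventually_atTop.1 (hc.eventually_le (by linarith : c < α))
  obtain ⟨m₁, hm₁⟩ := exists_nat_ge (max T₁ m₀)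
  have hm₁T : T₁ ≤ m₁ := (le_max_left _ _).trans hm₁
  have hm₁m : m₀ ≤ m₁ := by exact_mod_cast (le_max_right _ _).trans hm₁
  have htend : Tendsto (fun N : ℕ => ((N : ℝ) / 2) ^ (1 / α)) atTop atTop :=
    (tendsto_rpow_atTop (by positivity)).comp
      (tendsto_natCast_atTop_atTop.atTop_div_const two_pos)
  -- From `N₁` on, at least half of the count `(N / 2) ^ (1 / α)` survives the removal of the `m`
  -- below `m₁`.
  obtain ⟨N₁, hN₁⟩ := eventually_atTop.1 (htend.eventually_ge_atTop (2 * (m₁ : ℝ)))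
  -- For `N ≥ N₁` the factor `1 / 8` collects three halves: the weight, the removed initial `m`, and
  -- `2 ^ (1 / α) ≤ 2`. For smaller `N` the single element `f m₀` contributes at least `1 / N ^ 2`
  -- to the average.
  refine ⟨min (1 / 8) (1 / ((N₁ : ℝ) + 1) ^ 2), by positivity, fun N hN => ?_⟩
  have hN1 : (1 : ℝ) ≤ N := by exact_mod_cast (by omega : 1 ≤ N)
  have hN0 : (0 : ℝ) < N := by linarith
  rcases lt_or_ge N N₁ with hlt | hge
  · have h1 : (N : ℝ) ^ (-(1 - 1 / c + ε)) ≤ 1 := by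
      apply Real.rpow_le_one_of_one_le_of_nonpos hN1
      have : 1 / c ≤ 1 := by rw [div_le_one (by linarith)]; linarith
      linarith
    have h2 := havg N {f m₀} (by
      rw [Finset.singleton_subset_iff, Finset.mem_Icc]
      have := hfc m₀ le_rfl
      have := hfloor m₀ le_rfl
      omega)
    rw [Finset.sum_singleton] at h2
    have h3 := hval N m₀ le_rfl
    have h4 : 1 / (N : ℝ) ≤ 1 - (f m₀ : ℝ) / N := by
      have : (f m₀ : ℝ) + 1 ≤ N := by exact_mod_cast hN
      rw [one_sub_div hN0.ne']
      gcongr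
      linarith
    have h5 : 1 / ((N₁ : ℝ) + 1) ^ 2 ≤ 1 / (N : ℝ) * (1 / (N : ℝ)) := by
      rw [one_div_mul_one_div, ← sq]
      have : (N : ℝ) ≤ N₁ := by exact_mod_cast hlt.le
      gcongr
      linarith
    have h6 : 1 / (N : ℝ) * (1 / (N : ℝ)) ≤ 1 / (N : ℝ) * fejerFloor h N (f m₀ : ℤ) :=
      mul_le_mul_of_nonneg_left (h4.trans h3) (by positivity)
    calc _ ≤ min (1 / 8) (1 / ((N₁ : ℝ) + 1) ^ 2) * 1 :=
          mul_le_mul_of_nonneg_left h1 (by positivity)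
      _ ≤ 1 / ((N₁ : ℝ) + 1) ^ 2 := by rw [mul_one]; exact min_le_right _ _
      _ ≤ _ := h5.trans (h6.trans h2)
  · set X := ((N : ℝ) / 2) ^ (1 / α) with hX
    have hX0 : 0 ≤ X := by positivity
    set s := (Finset.Icc m₁ ⌊X⌋₊) with hs
    have hs1 : ∀ m ∈ s, m₁ ≤ m ∧ (f m : ℝ) ≤ N / 2 := by
      intro m hm
      obtain ⟨a1, a2⟩ := Finset.mem_Icc.1 hm
      refine ⟨a1, ?_⟩
      have hmX : (m : ℝ) ≤ X := (Nat.le_floor_iff hX0).1 a2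
      have hm1' : (m₁ : ℝ) ≤ m := by exact_mod_cast a1
      have h1 : h m ≤ (m : ℝ) ^ α := hT₁ m (hm₁T.trans hm1')
      have h2 : (m : ℝ) ^ α ≤ X ^ α := Real.rpow_le_rpow (Nat.cast_nonneg _) hmX hα0.le
      have h3 : X ^ α = N / 2 := by
        rw [hX, ← Real.rpow_mul (by positivity), one_div_mul_cancel hα0.ne', Real.rpow_one]
      have h4 : (f m : ℝ) = (⌊h m⌋ : ℝ) := by exact_mod_cast congrArg (Int.cast (R := ℝ)) (hfc m (hm₁m.trans a1))
      rw [h4]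
      linarith [Int.floor_le (h m)]
    have hinj : Set.InjOn f s := by
      intro a ha b hb hab
      have ha' := hm₁m.trans (hs1 a ha).1
      have hb' := hm₁m.trans (hs1 b hb).1
      rcases lt_trichotomy a b with hlt | heq | hlt
      · exact absurd hab (hflt a b ha' hlt).ne
      · exact heq
      · exact absurd hab (hflt b a hb' hlt).ne'
    have h1 := havg N (s.image f) (by
      intro n hn
      obtain ⟨m, hm, rfl⟩ := Finset.mem_image.1 hn
      obtain ⟨a1, a2⟩ := hs1 m hm
      have b1 := hfc m (hm₁m.trans a1)
      have b2 := hfloor m (hm₁m.trans a1)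
      have b3 : (f m : ℝ) ≤ N := by linarith
      rw [Finset.mem_Icc]
      exact ⟨by omega, by exact_mod_cast b3⟩)
    rw [Finset.sum_image hinj] at h1
    have h2 : (s.card : ℝ) * (1 / 2) ≤ ∑ m ∈ s, fejerFloor h N (f m : ℤ) := by
      rw [← nsmul_eq_mul, ← Finset.sum_const]
      apply Finset.sum_le_sum
      intro m hm
      obtain ⟨a1, a2⟩ := hs1 m hm
      refine le_trans ?_ (hval N m (hm₁m.trans a1))
      have : (f m : ℝ) / N ≤ 1 / 2 := by rw [div_le_iff₀ hN0]; linarith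
      linarith
    have hXm := hN₁ N hge
    have h3 : X / 2 ≤ s.card := by
      rw [hs, Nat.card_Icc]
      have h4 := Nat.lt_floor_add_one X
      have h5 : ((⌊X⌋₊ + 1 : ℕ) : ℝ) ≤ ((⌊X⌋₊ + 1 - m₁ : ℕ) : ℝ) + m₁ := by
        exact_mod_cast (by omega : ⌊X⌋₊ + 1 ≤ ⌊X⌋₊ + 1 - m₁ + m₁)
      push_cast at h5
      linarith
    have h4 : (N : ℝ) ^ (1 / c - ε) / 2 ≤ X := by
      rw [hX, Real.div_rpow hN0.le two_pos.le]
      have i1 : (N : ℝ) ^ (1 / c - ε) ≤ (N : ℝ) ^ (1 / α) := Real.rpow_le_rpow_of_exponent_le hN1 hexp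
      have i2 : (2 : ℝ) ^ (1 / α) ≤ 2 := by
        have : 1 / α ≤ 1 := by rw [div_le_one hα0]; linarith
        calc (2 : ℝ) ^ (1 / α) ≤ 2 ^ (1 : ℝ) := Real.rpow_le_rpow_of_exponent_le one_le_two this
          _ = 2 := Real.rpow_one 2
      exact div_le_div₀ (Real.rpow_nonneg hN0.le _) i1 (Real.rpow_pos_of_pos two_pos _) i2
    have e : (N : ℝ) ^ (-(1 - 1 / c + ε)) = 1 / N * (N : ℝ) ^ (1 / c - ε) := by
      rw [show -(1 - 1 / c + ε) = (1 / c - ε) - 1 by ring, Real.rpow_sub hN0, Real.rpow_one]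
      ring
    refine le_trans ?_ h1
    rw [e, mul_left_comm]
    apply mul_le_mul_of_nonneg_left _ (by positivity)
    have i3 : min (1 / 8) (1 / ((N₁ : ℝ) + 1) ^ 2) * (N : ℝ) ^ (1 / c - ε) ≤
        1 / 8 * (N : ℝ) ^ (1 / c - ε) :=
      mul_le_mul_of_nonneg_right (min_le_left _ _) (Real.rpow_nonneg hN0.le _)
    linarith

theorem mainTheorem3 (H : Subring (Germ (atTop : Filter ℝ) ℝ)) (hH : IsHardyField H)
    (h : ℝ → ℝ) (hh : (h : Germ (atTop : Filter ℝ) ℝ) ∈ H)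
    (hpos : ∀ᶠ t : ℝ in atTop, 0 < h t)
    (c : ℝ) (hc1 : 1 < c) (hc2 : c < 6 / 5) (hc : HasGrowthRate h c) :
    (∀ ε : ℝ, 0 < ε → ∃ C : ℝ, 0 < C ∧ ∀ N : ℕ, 1 ≤ N → ∀ ξ : ℝ,
      -(C * (N : ℝ) ^ (-(1 / (5 * c)) + ε)) ≤
        avg N (fun n => fejerFloor h N n * Real.cos (2 * Real.pi * ξ * (n : ℝ)))) ∧
    (∃ N₀ : ℕ, ∀ ε : ℝ, 0 < ε → ∃ C : ℝ, 0 < C ∧ ∀ N : ℕ, N₀ ≤ N →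
      C * (N : ℝ) ^ (-(1 - 1 / c + ε)) ≤ avg N (fejerFloor h N)) := by
  have hc3 : c < 2 := by linarith
  refine ⟨fun ε hε => ?_, exists_avg_fejerFloor_ge hH hh hpos hc1 hc3 hc⟩
  obtain ⟨C, hC, hbound⟩ := exists_avg_fejerFloor_mul_cos_ge hH hh hpos hc1 hc3 hc
  refine ⟨C, hC, fun N hN ξ => le_trans (neg_le_neg ?_) (hbound N hN ξ)⟩
  apply mul_le_mul_of_nonneg_left _ hC.le
  exact Real.rpow_le_rpow_of_exponent_le (by exact_mod_cast hN) (by linarith)
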